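/- Let $D$ be a link projection on the plane $\mathbb{R}^2$ or on the sphere $S^2$: finitely many closed curves (the components of $D$), each a smooth immersed circle, whose union has no singular points other than transverse double points, called crossings; or let $D$ be a link diagram, that is, a link projection with over/under information at each crossing. Suppose that $D$ has $n\ge 1$ crossings. The regions of $D$ are the connected components of the complement of the union of the curves. Around each crossing there are four corners. Let $A_{d2}(D)$ be the integer matrix with rows indexed by the crossings and columns indexed by the regions of $D$, whose entry at $(y,R)$ is $2$ if $R$ touches $y$ twice (that is, at two different corners of $y$), is $1$ if $R$ does not touch $y$ twice but $y\in\partial R$, and is $0$ if $y\notin\partial R$. Let $x$ be a crossing of $D$ at which two arcs of the same component cross. Then there is an integer vector $\mathbf{v}_x$, indexed by the regions of $D$, such that the component of $A_{d2}(D)\mathbf{v}_x$ at $x$ is $1$ and all its other components are $0$. -/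

import Mathlib

open Set Filter Topology
open scoped ContDiff

/-- A link projection on a surface `S` lying in a Euclidean space `E` (below: the plane, and the
unit sphere in 3-space).  It consists of `l` closed curves, the components, which are smooth
immersed circles in `S`, given by `1`-periodic parametrizations; the only singular points of their
union are transverse double points.  A link diagram is a link projection together with over/under
information at the crossings; none of the notions below depends on that information. -/
structure LinkProjection {E : Type} [NormedAddCommGroup E] [NormedSpace ℝ E] (S : Set E) where
  /-- the number of components -/
  l : ℕ
  /-- the parametrizations of the components -/
  curve : Fin l → ℝ → E
  mem_surface : ∀ i t, curve i t ∈ S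
  periodic : ∀ i, Function.Periodic (curve i) 1
  smooth : ∀ i, ContDiff ℝ ∞ (curve i)
  immersed : ∀ i t, deriv (curve i) t ≠ 0
  /-- no point of the surface is passed more than twice -/
  double : ∀ p : E, {q : Fin l × ℝ | q.2 ∈ Ico (0 : ℝ) 1 ∧ curve q.1 q.2 = p}.encard ≤ 2
  /-- where two different branches meet, they have different tangent lines -/
  transverse : ∀ i j s t, s ∈ Ico (0 : ℝ) 1 → t ∈ Ico (0 : ℝ) 1 → (i, s) ≠ (j, t) →
    curve i s = curve j t → LinearIndependent ℝ ![deriv (curve i) s, deriv (curve j) t]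

namespace LinkProjection

variable {E : Type} [NormedAddCommGroup E] [NormedSpace ℝ E] {S : Set E} (D : LinkProjection S)

/-- The projection image: the union of the components. -/
def image : Set E := {p | ∃ i t, D.curve i t = p}

/-- A point is a crossing if two different branches pass through it. -/
def IsCrossing (p : E) : Prop :=
  ∃ i j s t, s ∈ Ico (0 : ℝ) 1 ∧ t ∈ Ico (0 : ℝ) 1 ∧ (i, s) ≠ (j, t) ∧
    D.curve i s = p ∧ D.curve j t = p

/-- The set of crossings `x₁, …, xₙ`. -/
def Crossing : Type := {p : E // D.IsCrossing p}

/-- A crossing of arcs in the same component. -/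
def IsSelfCrossing (x : D.Crossing) : Prop :=
  ∃ i s t, s ∈ Ico (0 : ℝ) 1 ∧ t ∈ Ico (0 : ℝ) 1 ∧ s ≠ t ∧
    D.curve i s = x.1 ∧ D.curve i t = x.1

/-- The set of regions: the connected components of the complement of the projection image in
the surface. -/
def Region : Type := {R : Set E // ∃ p ∈ S \ D.image, R = connectedComponentIn (S \ D.image) p}

/-- The boundary of a region in the surface.  (A region is open in the closed surface `S`, so
its boundary in `S` consists of the points of its closure that do not belong to it.) -/
def boundary (R : D.Region) : Set E := closure R.1 \ R.1

/-- The directions in which half-branches leave the point `p`.  At a crossing whose two branches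
have the velocities `a` and `b` these are `a`, `-a`, `b` and `-b`. -/
def halfTangents (p : E) : Set E :=
  {h | ∃ i t, D.curve i t = p ∧ (h = deriv (D.curve i) t ∨ h = -deriv (D.curve i) t)}

/-- The corners at the crossing `x`.  A corner lies between two half-branches leaving `x` in
independent directions `h` and `k`; it is recorded by the direction `h + k`, which points into it.
If the branches have the velocities `a` and `b`, the four corners are `a + b`, `a - b`, `-a + b`,
`-a - b`. -/
def corners (x : D.Crossing) : Set E :=
  {w | ∃ h ∈ D.halfTangents x.1, ∃ k ∈ D.halfTangents x.1,
    LinearIndependent ℝ ![h, k] ∧ w = h + k}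

/-- The region `R` touches the crossing `x` at the corner `w`: from `x` one can start in the
direction `w` inside `R`. -/
def TouchesAt (R : D.Region) (x : D.Crossing) (w : E) : Prop :=
  w ∈ D.corners x ∧ ∃ c : ℝ → E, c 0 = x.1 ∧ HasDerivWithinAt c w (Ioi 0) 0 ∧
    ∀ᶠ r in 𝓝[>] (0 : ℝ), c r ∈ R.1

/-- The region `R` touches the crossing `x` twice, that is, at two different corners. -/
def TouchesTwice (R : D.Region) (x : D.Crossing) : Prop :=
  ∃ w w', w ≠ w' ∧ D.TouchesAt R x w ∧ D.TouchesAt R x w'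

open Classical in
/-- The definite region choice matrix of the single counting rule. -/
noncomputable def matrixD1 : Matrix D.Crossing D.Region ℤ :=
  Matrix.of fun x R => if x.1 ∈ D.boundary R then 1 else 0

open Classical in
/-- The definite region choice matrix of the double counting rule. -/
noncomputable def matrixD2 : Matrix D.Crossing D.Region ℤ :=
  Matrix.of fun x R => if D.TouchesTwice R x then 2 else D.matrixD1 x R

/-- The vector `A_{d2}(D) v`, where `v` assigns integers to (finitely many of) the regions. -/
noncomputable def applyD2 (v : D.Region →₀ ℤ) : D.Crossing → ℤ :=
  fun x => v.sum fun R u => D.matrixD2 x R * u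

end LinkProjection

/-! Between its two passages of `x`, the component through `x` traces a closed loop with a corner at
`x`. Let `F R` be the winding number of this loop about the region `R`, and let `ε R = ±1` be the
parity of the total winding number of all components about `R`, which changes across each branch: a
checkerboard coloring. The required vector is `± ε F`, cut down to the finitely many regions that
touch a crossing.

Since `ε` alternates around a crossing, neighbouring corners lie in different regions, so the
entries of the double counting rule are exactly numbers of corners (`matrixD2_eq`). Hence the
component of the product at `y` is, up to sign, the alternating sum of `F` over the four corners of
`y`. For `y ≠ x` the loop contains each branch at `y` entirely or not at all, and the jump across a
full branch is odd under `w ↦ -w`, so opposite corners cancel (`alternating_sum_eq_zero`). At `x`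
the loop consists of one half of each branch, which separates one corner from the other three; the
alternating sum is `±1` (`alternating_sum_base`).

Winding numbers are integrals of `dz / (z - p)` in a planar chart, and they are compared at a
crossing by letting `p` tend to it along the four corner directions. A half-branch contributes a
term that diverges like `log r`, but this term is the same for all corners and cancels in
combinations whose coefficients sum to zero (`sum_winding`). On the sphere the chart is
stereographic projection from a point off the image; the integral tends to zero at infinity, so the
winding number extends over the missing point. -/

/-! ### Winding integrals of plane arcs. -/

/-- The integral of `dz / (z - p)` along the curve `c` from the time `s` to the time `t`. -/
noncomputable def logInt (c : ℝ → ℂ) (s t : ℝ) (p : ℂ) : ℂ :=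
  ∫ τ in s..t, deriv c τ / (c τ - p)

section LogInt

variable {c : ℝ → ℂ} {s t m : ℝ} {p z : ℂ}

lemma continuousOn_logInt_integrand (hc : ContDiff ℝ 1 c) {K : Set ℝ} (hp : ∀ τ ∈ K, c τ ≠ p) :
    ContinuousOn (fun τ => deriv c τ / (c τ - p)) K :=
  (hc.continuous_deriv le_rfl).continuousOn.div
    (hc.continuous.sub continuous_const).continuousOn fun τ hτ => sub_ne_zero.2 (hp τ hτ)

lemma intervalIntegrable_logInt_integrand (hc : ContDiff ℝ 1 c)
    (hp : ∀ τ ∈ uIcc s t, c τ ≠ p) :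
    IntervalIntegrable (fun τ => deriv c τ / (c τ - p)) MeasureTheory.volume s t :=
  (continuousOn_logInt_integrand hc hp).intervalIntegrable

lemma logInt_add (hc : ContDiff ℝ 1 c) (h₁ : ∀ τ ∈ uIcc s m, c τ ≠ p)
    (h₂ : ∀ τ ∈ uIcc m t, c τ ≠ p) :
    logInt c s m p + logInt c m t p = logInt c s t p :=
  intervalIntegral.integral_add_adjacent_intervals
    (intervalIntegrable_logInt_integrand hc h₁) (intervalIntegrable_logInt_integrand hc h₂)

lemma logInt_symm : logInt c t s p = -logInt c s t p :=
  intervalIntegral.integral_symm _ _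

lemma hasDerivAt_of_contDiff_one (hc : ContDiff ℝ 1 c) (τ : ℝ) : HasDerivAt c (deriv c τ) τ :=
  (hc.differentiable one_ne_zero τ).hasDerivAt

/-- A curve that stays in a slit plane. -/
lemma logInt_eq_log_sub_log (hc : ContDiff ℝ 1 c) (h : ℂ)
    (hs : ∀ τ ∈ uIcc s t, (c τ - p) / h ∈ Complex.slitPlane) :
    logInt c s t p = Complex.log ((c t - p) / h) - Complex.log ((c s - p) / h) := by
  have hne : ∀ τ ∈ uIcc s t, c τ ≠ p := fun τ hτ e =>
    Complex.slitPlane_ne_zero (hs τ hτ) (by simp [e])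
  refine intervalIntegral.integral_eq_sub_of_hasDerivAt
    (f := fun τ => Complex.log ((c τ - p) / h)) (fun τ hτ => ?_)
    (intervalIntegrable_logInt_integrand hc hne)
  have hh : h ≠ 0 := fun e => Complex.slitPlane_ne_zero (hs τ hτ) (by simp [e])
  have h1 := (((hasDerivAt_of_contDiff_one hc τ).sub_const p).div_const h).clog_real (hs τ hτ)
  refine h1.congr_deriv ?_
  have := sub_ne_zero.2 (hne τ hτ)
  field_simp

/-- The function `exp (-logInt c s x p) * (c x - p)` of `x` has derivative zero, so no choice of a
continuous logarithm along the arc is needed. -/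
lemma exp_logInt_mul (hc : ContDiff ℝ 1 c) (hst : s ≤ t) (hp : ∀ τ ∈ Icc s t, c τ ≠ p) :
    Complex.exp (logInt c s t p) * (c s - p) = c t - p := by
  have hcont := continuousOn_logInt_integrand hc hp
  have hint : IntervalIntegrable (fun τ => deriv c τ / (c τ - p)) MeasureTheory.volume s t :=
    intervalIntegrable_logInt_integrand hc (by rwa [uIcc_of_le hst])
  have key : ∀ x ∈ Icc s t, Complex.exp (-logInt c s x p) * (c x - p)
      = Complex.exp (-logInt c s s p) * (c s - p) := by
    refine constant_of_has_deriv_right_zero ?_ ?_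
    · refine ContinuousOn.mul ?_ (hc.continuous.sub continuous_const).continuousOn
      refine Complex.continuous_exp.comp_continuousOn (ContinuousOn.neg ?_)
      have := intervalIntegral.continuousOn_primitive_interval (μ := MeasureTheory.volume)
        (f := fun τ => deriv c τ / (c τ - p)) (a := s) (b := t)
        (by rw [uIcc_of_le hst]; exact hcont.integrableOn_Icc)
      rwa [uIcc_of_le hst] at this
    · intro x hx
      have hx' : x ∈ Icc s t := Ico_subset_Icc_self hx
      have hd : HasDerivWithinAt (fun u => logInt c s u p) (deriv c x / (c x - p)) (Ici x) x := by
        refine intervalIntegral.integral_hasDerivWithinAt_right (t := Ioi x) ?_ ?_ ?_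
        · exact intervalIntegrable_logInt_integrand hc
            fun τ hτ => hp τ (by rw [uIcc_of_le hx.1] at hτ; exact ⟨hτ.1, hτ.2.trans hx'.2⟩)
        · refine ⟨Ioo x t, Ioo_mem_nhdsGT hx.2, ?_⟩
          exact (hcont.mono fun y hy => ⟨hx.1.trans hy.1.le, hy.2.le⟩).aestronglyMeasurable
            measurableSet_Ioo
        · have : ContinuousWithinAt (fun τ => deriv c τ / (c τ - p)) (Icc s t) x := hcont x hx'
          exact ContinuousAt.continuousWithinAt (((hc.continuous_deriv le_rfl).continuousAt).div
            (hc.continuous.sub continuous_const).continuousAt (sub_ne_zero.2 (hp x hx')))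
      have h2 := (hd.neg.cexp).mul
        ((hasDerivAt_of_contDiff_one hc x).sub_const p).hasDerivWithinAt
      refine h2.congr_deriv ?_
      have := sub_ne_zero.2 (hp x hx')
      field_simp
      ring
  have h := key t ⟨hst, le_rfl⟩
  have h0 : logInt c s s p = 0 := intervalIntegral.integral_same
  rw [h0, neg_zero, Complex.exp_zero, one_mul] at h
  rw [← h, ← mul_assoc, ← Complex.exp_add, add_neg_cancel, Complex.exp_zero, one_mul]

/-- The winding number of a closed curve is an integer. -/
lemma exists_logInt_eq_int_mul (hc : ContDiff ℝ 1 c) (hst : s ≤ t)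
    (hp : ∀ τ ∈ Icc s t, c τ ≠ p) (hcl : c s = c t) :
    ∃ n : ℤ, logInt c s t p = n * (2 * Real.pi * Complex.I) := by
  have h := exp_logInt_mul hc hst hp
  rw [← hcl] at h
  have h0 : c s - p ≠ 0 := sub_ne_zero.2 (hp s ⟨le_rfl, hst⟩)
  exact Complex.exp_eq_one_iff.1 (mul_right_cancel₀ h0 (by rw [h, one_mul]))

lemma norm_logInt_le (hst : s ≤ t) {C d : ℝ} (hd : 0 < d)
    (hC : ∀ τ ∈ Icc s t, ‖deriv c τ‖ ≤ C) (hp : ∀ τ ∈ Icc s t, d ≤ ‖c τ - p‖) :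
    ‖logInt c s t p‖ ≤ C / d * (t - s) := by
  have := intervalIntegral.norm_integral_le_of_norm_le_const (a := s) (b := t) (C := C / d)
    (f := fun τ => deriv c τ / (c τ - p)) (fun τ hτ => by
      rw [uIoc_of_le hst] at hτ
      have hτ' := Ioc_subset_Icc_self hτ
      rw [norm_div]
      have := hC τ hτ'
      exact div_le_div₀ ((norm_nonneg _).trans this) this hd (hp τ hτ'))
  rwa [abs_of_nonneg (sub_nonneg.2 hst)] at this

lemma exists_norm_deriv_le (hc : ContDiff ℝ 1 c) (s t : ℝ) :
    ∃ C, ∀ τ ∈ Icc s t, ‖deriv c τ‖ ≤ C :=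
  isCompact_Icc.exists_bound_of_continuousOn (hc.continuous_deriv le_rfl).continuousOn

/-- This limit makes the winding number continuous at the pole of the stereographic chart, with
value zero. -/
lemma tendsto_logInt_cocompact (hc : ContDiff ℝ 1 c) (hst : s ≤ t) :
    Tendsto (logInt c s t) (cocompact ℂ) (𝓝 0) := by
  obtain ⟨C, hC⟩ := exists_norm_deriv_le hc s t
  obtain ⟨M, hM⟩ := isCompact_Icc.exists_bound_of_continuousOn (s := Icc s t)
    hc.continuous.continuousOn
  have h1 : Tendsto (fun p : ℂ => ‖p‖ - M) (cocompact ℂ) atTop :=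
    tendsto_atTop_add_const_right _ _ (tendsto_norm_cocompact_atTop)
  have h2 : Tendsto (fun p : ℂ => C / (‖p‖ - M) * (t - s)) (cocompact ℂ) (𝓝 0) := by
    simpa using (h1.const_div_atTop C).mul_const (t - s)
  refine squeeze_zero_norm' ?_ h2
  filter_upwards [h1.eventually_gt_atTop 0] with p hp
  refine norm_logInt_le hst hp hC fun τ hτ => ?_
  have := norm_sub_norm_le p (c τ)
  rw [norm_sub_rev] at this
  linarith [hM τ hτ]

/-- Dominated convergence: the arc is compact, so it keeps a distance `d` from `p`, hence `d / 2`
from all nearby points. -/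
lemma continuousAt_logInt (hc : ContDiff ℝ 1 c) (hst : s ≤ t) (hp : ∀ τ ∈ Icc s t, c τ ≠ p) :
    ContinuousAt (logInt c s t) p := by
  obtain ⟨C, hC⟩ := exists_norm_deriv_le hc s t
  have hcl : IsClosed (c '' Icc s t) := (isCompact_Icc.image hc.continuous).isClosed
  have hmem : (c '' Icc s t)ᶜ ∈ 𝓝 p := hcl.isOpen_compl.mem_nhds (by
    rintro ⟨τ, hτ, e⟩; exact hp τ hτ e)
  obtain ⟨d, hd, hball⟩ := Metric.mem_nhds_iff.1 hmem
  have hfar : ∀ q ∈ Metric.ball p (d / 2), ∀ τ ∈ Icc s t, d / 2 ≤ ‖c τ - q‖ := by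
    intro q hq τ hτ
    by_contra! hlt
    refine hball (a := c τ) ?_ ⟨τ, hτ, rfl⟩
    rw [Metric.mem_ball] at hq ⊢
    calc dist (c τ) p ≤ dist (c τ) q + dist q p := dist_triangle _ _ _
      _ < d := by rw [dist_eq_norm (c τ)]; linarith
  have hnear : ∀ᶠ q in 𝓝 p, q ∈ Metric.ball p (d / 2) := Metric.ball_mem_nhds _ (by positivity)
  refine intervalIntegral.continuousAt_of_dominated_interval (bound := fun _ => C / (d / 2))
    ?_ ?_ (by simp) ?_
  · filter_upwards [hnear] with q hq
    refine (continuousOn_logInt_integrand hc (K := uIoc s t) ?_).aestronglyMeasurable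
      measurableSet_uIoc
    intro τ hτ e
    rw [uIoc_of_le hst] at hτ
    have := hfar q hq τ (Ioc_subset_Icc_self hτ)
    rw [e, sub_self, norm_zero] at this
    linarith
  · filter_upwards [hnear] with q hq
    refine Eventually.of_forall fun τ hτ => ?_
    rw [uIoc_of_le hst] at hτ
    have hτ' := Ioc_subset_Icc_self hτ
    rw [norm_div]
    have := hC τ hτ'
    exact div_le_div₀ ((norm_nonneg _).trans this) this (by positivity) (hfar q hq τ hτ')
  · refine Eventually.of_forall fun τ hτ => ?_
    rw [uIoc_of_le hst] at hτ
    exact continuousAt_const.div (continuousAt_const.sub continuousAt_id)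
      (sub_ne_zero.2 (hp τ (Ioc_subset_Icc_self hτ)))

end LogInt

/-! ### Asymptotics of the winding integral near a point of the curve. -/

/-- `W(z + r w) - L(r) → g(w)` as `r → 0+`, where `W` is the integral `logInt` along the
arc and the (possibly divergent) term `L` does not depend on the direction `w ∈ G`. -/
def LogAsymptotic (c : ℝ → ℂ) (s t : ℝ) (z : ℂ) (G : Set ℂ) (g : ℂ → ℂ) : Prop :=
  ∃ L : ℝ → ℂ, ∀ w ∈ G, Tendsto (fun r : ℝ => logInt c s t (z + r * w) - L r) (𝓝[>] 0) (𝓝 (g w))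

section LogAsymptotic

variable {c : ℝ → ℂ} {s t m : ℝ} {z : ℂ} {G : Set ℂ} {g g₁ g₂ : ℂ → ℂ}

lemma tendsto_ray (z w : ℂ) : Tendsto (fun r : ℝ => z + r * w) (𝓝[>] 0) (𝓝 z) := by
  have : ContinuousAt (fun r : ℝ => z + r * w) 0 := by fun_prop
  have h := this.tendsto
  simp only [Complex.ofReal_zero, zero_mul, add_zero] at h
  exact h.mono_left nhdsWithin_le_nhds

lemma LogAsymptotic.symm (h : LogAsymptotic c s t z G g) :
    LogAsymptotic c t s z G fun w => -g w := by
  obtain ⟨L, hL⟩ := h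
  refine ⟨fun r => -L r, fun w hw => ?_⟩
  refine (hL w hw).neg.congr fun r => ?_
  rw [logInt_symm (s := s)]
  ring

lemma LogAsymptotic.trans (hc : ContDiff ℝ 1 c)
    (hG : ∀ w ∈ G, ∀ᶠ r : ℝ in 𝓝[>] 0, ∀ τ, c τ ≠ z + r * w)
    (h₁ : LogAsymptotic c s m z G g₁) (h₂ : LogAsymptotic c m t z G g₂) :
    LogAsymptotic c s t z G fun w => g₁ w + g₂ w := by
  obtain ⟨L₁, h₁⟩ := h₁
  obtain ⟨L₂, h₂⟩ := h₂
  refine ⟨fun r => L₁ r + L₂ r, fun w hw => ?_⟩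
  refine ((h₁ w hw).add (h₂ w hw)).congr' ?_
  filter_upwards [hG w hw] with r hr
  rw [← logInt_add (s := s) (t := t) (m := m) hc (fun τ _ => hr τ) (fun τ _ => hr τ)]
  ring

lemma LogAsymptotic.of_forall_ne (hc : ContDiff ℝ 1 c) (hst : s ≤ t)
    (hz : ∀ τ ∈ Icc s t, c τ ≠ z) : LogAsymptotic c s t z G fun _ => 0 := by
  refine ⟨fun _ => logInt c s t z, fun w _ => ?_⟩
  have := ((continuousAt_logInt hc hst hz).tendsto.comp (tendsto_ray z w)).sub_const
    (logInt c s t z)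
  simpa using this

/-- On the closed negative axis the imaginary parts of `u` and `r * w` agree, so `r` is at most `ε *
τ / |w.im|`. Then `r * w.re` is too small to outweigh `u.re`, which is at least `(1 - ε) * τ`. -/
lemma mem_slitPlane_of_near_ray {u w : ℂ} {ε τ r : ℝ} (hε : 0 < ε)
    (hεw : ε * (1 + ‖w‖ / |w.im|) < 1) (hw : w.im ≠ 0) (hr : 0 < r) (hτ : 0 ≤ τ)
    (hu : ‖u - τ‖ ≤ ε * τ) : u - r * w ∈ Complex.slitPlane := by
  rw [Complex.mem_slitPlane_iff]
  by_contra! hcon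
  obtain ⟨hre, him⟩ := hcon
  simp only [Complex.sub_re, Complex.sub_im, Complex.re_ofReal_mul, Complex.im_ofReal_mul]
    at hre him
  have h1 : |u.im| ≤ ε * τ := by
    have := (Complex.abs_im_le_norm (u - τ)).trans hu
    simpa using this
  have h2 : |u.re - τ| ≤ ε * τ := by
    have := (Complex.abs_re_le_norm (u - τ)).trans hu
    simpa using this
  have h3 : u.im = r * w.im := by linarith
  rw [h3, abs_mul, abs_of_pos hr] at h1
  have hi : 0 < |w.im| := abs_pos.2 hw
  have hτ0 : 0 < τ := by
    rcases hτ.eq_or_lt with h | h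
    · rw [← h, mul_zero] at h1
      nlinarith [mul_pos hr hi]
    · exact h
  have h4 : r ≤ ε * τ / |w.im| := by rwa [le_div_iff₀ hi]
  have h5 : r * w.re ≤ ε * τ / |w.im| * ‖w‖ :=
    (mul_le_mul_of_nonneg_left ((le_abs_self _).trans (Complex.abs_re_le_norm w)) hr.le).trans
      (mul_le_mul_of_nonneg_right h4 (norm_nonneg w))
  have h6 : ε * τ / |w.im| * ‖w‖ + ε * τ = τ * (ε * (1 + ‖w‖ / |w.im|)) := by
    field_simp; ring
  have h7 := mul_lt_mul_of_pos_left hεw hτ0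
  have := (abs_le.1 h2).1
  linarith

/-- The contribution of a short arc that leaves `z` in the direction `σ c'(α)`. -/
lemma eventually_logAsymptotic_half (hc : ContDiff ℝ 1 c) {α σ : ℝ} (hσ : σ ≠ 0) (hα : c α = z)
    (hα' : deriv c α ≠ 0) (hfin : G.Finite) (hG : ∀ w ∈ G, (w / deriv c α).im ≠ 0) :
    ∀ᶠ δ in 𝓝[>] (0 : ℝ), LogAsymptotic c α (α + σ * δ) z G
      fun w => -Complex.log (-w / (σ * deriv c α)) := by
  set h : ℂ := σ * deriv c α with hh
  have hσ' : (σ : ℂ) ≠ 0 := by exact_mod_cast hσ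
  have hh0 : h ≠ 0 := mul_ne_zero hσ' hα'
  have him : ∀ w ∈ G, (w / h).im ≠ 0 := by
    intro w hw
    have : w / h = ((σ⁻¹ : ℝ) : ℂ) * (w / deriv c α) := by
      rw [hh]; push_cast; field_simp
    rw [this, Complex.im_ofReal_mul]
    exact mul_ne_zero (inv_ne_zero hσ) (hG w hw)
  -- Rescaled so that it leaves `0` with velocity `1`, the arc is close to the positive real axis.
  set u : ℝ → ℂ := fun τ => (c (α + σ * τ) - z) / h with hu
  have hu' : HasDerivAt u 1 0 := by
    have h1 : HasDerivAt (fun τ : ℝ => α + σ * τ) σ 0 := by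
      simpa using ((hasDerivAt_id (0 : ℝ)).const_mul σ).const_add α
    have h2 : HasDerivAt c (deriv c α) (α + σ * 0) := by
      simpa using hasDerivAt_of_contDiff_one hc α
    have h3 := ((h2.scomp (0 : ℝ) h1).sub_const z).div_const h
    refine h3.congr_deriv ?_
    rw [Complex.real_smul, ← hh, div_self hh0]
  have hu0 : u 0 = 0 := by simp [hu, hα]
  have hsmall : ∀ ε : ℝ, 0 < ε → ∀ᶠ δ in 𝓝[>] (0 : ℝ), ∀ τ ∈ Icc 0 δ, ‖u τ - τ‖ ≤ ε * τ := by
    intro ε hε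
    have h1 := hu'.isLittleO.def hε
    obtain ⟨δ₀, hδ₀, hb⟩ := Metric.eventually_nhds_iff.1 h1
    filter_upwards [Ioo_mem_nhdsGT hδ₀] with δ hδ τ hτ
    have := hb (y := τ) (by
      rw [Real.dist_eq, sub_zero, abs_of_nonneg hτ.1]; exact hτ.2.trans_lt hδ.2)
    simpa [hu0, abs_of_nonneg hτ.1] using this
  -- The integral is a difference of principal logarithms. The one at the starting point is `log (r
  -- * (-w / h)) = log r + log (-w / h)`, so the divergent part does not involve `w`.
  have hev : ∀ w ∈ G, ∀ᶠ δ in 𝓝[>] (0 : ℝ),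
      Tendsto (fun r : ℝ => logInt c α (α + σ * δ) (z + r * w)
        - (Complex.log (u δ) - Real.log r)) (𝓝[>] 0) (𝓝 (-Complex.log (-w / h))) := by
    intro w hw
    obtain ⟨ε, hε, hεw⟩ : ∃ ε : ℝ, 0 < ε ∧ ε * (1 + ‖w / h‖ / |(w / h).im|) < 1 := by
      have hpos : 0 < 1 + ‖w / h‖ / |(w / h).im| := by positivity
      refine ⟨(1 + ‖w / h‖ / |(w / h).im|)⁻¹ / 2, by positivity, ?_⟩
      field_simp
      norm_num
    have hε1 : ε < 1 := by
      have : 0 ≤ ‖w / h‖ / |(w / h).im| := by positivity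
      nlinarith
    filter_upwards [hsmall ε hε, self_mem_nhdsWithin] with δ hδ hδ0
    have hδ0' : (0 : ℝ) < δ := hδ0
    have hslit : ∀ r : ℝ, 0 < r → ∀ τ ∈ uIcc α (α + σ * δ),
        (c τ - (z + r * w)) / h ∈ Complex.slitPlane := by
      intro r hr τ hτ
      have hτ' : (τ - α) / σ ∈ Icc 0 δ := by
        rcases lt_or_gt_of_ne hσ with hneg | hpos
        · rw [uIcc_of_ge (by nlinarith)] at hτ
          refine ⟨div_nonneg_of_nonpos (by linarith [hτ.2]) hneg.le, ?_⟩
          rw [div_le_iff_of_neg hneg]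
          linarith [hτ.1]
        · rw [uIcc_of_le (by nlinarith)] at hτ
          refine ⟨div_nonneg (by linarith [hτ.1]) hpos.le, ?_⟩
          rw [div_le_iff₀ hpos]
          linarith [hτ.2]
      have h1 := mem_slitPlane_of_near_ray hε hεw (him w hw) hr hτ'.1 (hδ _ hτ')
      have h2 : α + σ * ((τ - α) / σ) = τ := by field_simp; ring
      convert h1 using 1
      simp only [hu, h2]
      field_simp
      ring
    have huδ : u δ ∈ Complex.slitPlane := by
      rw [Complex.mem_slitPlane_iff]
      left
      have := (Complex.abs_re_le_norm _).trans (hδ δ ⟨hδ0'.le, le_rfl⟩)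
      simp only [Complex.sub_re, Complex.ofReal_re] at this
      have := (abs_le.1 this).1
      nlinarith
    have hlim : Tendsto (fun r : ℝ => Complex.log (u δ - r * (w / h)) - Complex.log (u δ)
        - Complex.log (-w / h)) (𝓝[>] 0) (𝓝 (-Complex.log (-w / h))) := by
      have h1 : Tendsto (fun r : ℝ => u δ - r * (w / h)) (𝓝[>] 0) (𝓝 (u δ)) := by
        have := tendsto_ray (u δ) (-(w / h))
        simpa [sub_eq_add_neg] using this
      have h2 := ((h1.clog huδ).sub_const (Complex.log (u δ))).sub_const
        (Complex.log (-w / h))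
      simpa using h2
    refine hlim.congr' ?_
    filter_upwards [self_mem_nhdsWithin] with r hr
    have hr' : (0 : ℝ) < r := hr
    have e1 : (c (α + σ * δ) - (z + r * w)) / h = u δ - r * (w / h) := by
      simp only [hu]; ring
    have e2 : (c α - (z + r * w)) / h = r * (-w / h) := by rw [hα]; ring
    have hw0 : -w / h ≠ 0 := by
      intro e
      apply him w hw
      rw [neg_div, neg_eq_zero] at e
      rw [e, Complex.zero_im]
    rw [logInt_eq_log_sub_log hc h (hslit r hr'), e1, e2, Complex.log_ofReal_mul hr' hw0]
    ring
  have hall := (eventually_all_finite hfin).2 hev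
  filter_upwards [hall] with δ hδ
  exact ⟨_, hδ⟩

/-- The jump function of a branch with the velocity `h`. -/
noncomputable def branchJump (h w : ℂ) : ℂ := Complex.log (w / h) - Complex.log (-w / h)

lemma branchJump_neg (h w : ℂ) : branchJump h (-w) = -branchJump h w := by
  simp [branchJump]

lemma eventually_logAsymptotic_right (hc : ContDiff ℝ 1 c) {α : ℝ} (hα : c α = z)
    (hα' : deriv c α ≠ 0) (hfin : G.Finite) (hG : ∀ w ∈ G, (w / deriv c α).im ≠ 0) :
    ∀ᶠ δ in 𝓝[>] (0 : ℝ), LogAsymptotic c α (α + δ) z G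
      fun w => -Complex.log (-w / deriv c α) := by
  simpa using eventually_logAsymptotic_half hc one_ne_zero hα hα' hfin hG

lemma eventually_logAsymptotic_left (hc : ContDiff ℝ 1 c) {α : ℝ} (hα : c α = z)
    (hα' : deriv c α ≠ 0) (hfin : G.Finite) (hG : ∀ w ∈ G, (w / deriv c α).im ≠ 0) :
    ∀ᶠ δ in 𝓝[>] (0 : ℝ), LogAsymptotic c (α - δ) α z G
      fun w => Complex.log (w / deriv c α) := by
  filter_upwards [eventually_logAsymptotic_half hc (neg_ne_zero.2 one_ne_zero) hα hα' hfin hG]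
    with δ hδ
  have := hδ.symm
  simpa [neg_div_neg_eq, ← sub_eq_add_neg] using this

lemma eventually_forall_gt_sub {T : Finset ℝ} {m : ℝ} (h : ∀ τ ∈ T, τ < m) :
    ∀ᶠ δ in 𝓝[>] (0 : ℝ), ∀ τ ∈ T, τ < m - δ := by
  refine (eventually_all_finset T).2 fun τ hτ => ?_
  filter_upwards [Ioo_mem_nhdsGT (sub_pos.2 (h τ hτ))] with δ hδ
  linarith [hδ.2]

/-- An arc that passes through `z` only at the times in `T`, all of them interior. -/
lemma logAsymptotic_of_interior (hc : ContDiff ℝ 1 c) (hc' : ∀ τ, deriv c τ ≠ 0)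
    (hfin : G.Finite) (hray : ∀ w ∈ G, ∀ᶠ r : ℝ in 𝓝[>] 0, ∀ τ, c τ ≠ z + r * w)
    (T : Finset ℝ) (hT : ∀ τ ∈ T, c τ = z)
    (hG : ∀ τ ∈ T, ∀ w ∈ G, (w / deriv c τ).im ≠ 0) :
    ∀ t, s ≤ t → (∀ τ ∈ T, τ ∈ Ioo s t) → (∀ τ ∈ Icc s t, c τ = z → τ ∈ T) →
      LogAsymptotic c s t z G fun w => ∑ τ ∈ T, branchJump (deriv c τ) w := by
  induction T using Finset.induction_on_max with
  | empty =>
    intro t hst _ h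
    simpa using LogAsymptotic.of_forall_ne hc hst fun τ hτ e => by simpa using h τ hτ e
  -- The last passage `m` is isolated by cutting at `m - δ`, `m` and `m + δ`; its two halves add up
  -- to one `branchJump`.
  | insert m T hm ih =>
    intro t hst hin hall
    have hmT : m ∉ T := fun h => lt_irrefl _ (hm m h)
    have hmem : m ∈ insert m T := Finset.mem_insert_self _ _
    have hmst := hin m hmem
    have e1 := eventually_logAsymptotic_left hc (hT m hmem) (hc' m) hfin (hG m hmem)
    have e2 := eventually_logAsymptotic_right hc (hT m hmem) (hc' m) hfin (hG m hmem)
    have e4 : ∀ᶠ δ in 𝓝[>] (0 : ℝ), δ ∈ Ioo 0 (m - s) := Ioo_mem_nhdsGT (sub_pos.2 hmst.1)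
    have e5 : ∀ᶠ δ in 𝓝[>] (0 : ℝ), δ ∈ Ioo 0 (t - m) := Ioo_mem_nhdsGT (sub_pos.2 hmst.2)
    obtain ⟨δ, h1, h2, h3, h4, h5⟩ :=
      (e1.and <| e2.and <| (eventually_forall_gt_sub hm).and <| e4.and e5).exists
    have hδ' : 0 < δ := h4.1
    have A := ih (fun τ hτ => hT τ (Finset.mem_insert_of_mem hτ))
      (fun τ hτ => hG τ (Finset.mem_insert_of_mem hτ)) (m - δ) (by linarith [h4.2])
      (fun τ hτ => ⟨(hin τ (Finset.mem_insert_of_mem hτ)).1, h3 τ hτ⟩) (fun τ hτ e => by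
        rcases Finset.mem_insert.1 (hall τ ⟨hτ.1, by linarith [hτ.2, hmst.2]⟩ e) with h | h
        · linarith [hτ.2]
        · exact h)
    have B : LogAsymptotic c (m + δ) t z G fun _ => 0 := by
      refine LogAsymptotic.of_forall_ne hc (by linarith [h5.2]) fun τ hτ e => ?_
      rcases Finset.mem_insert.1 (hall τ ⟨by linarith [hτ.1, hmst.1], hτ.2⟩ e) with h | h
      · linarith [hτ.1]
      · linarith [hτ.1, hm τ h]
    have := ((A.trans hc hray h1).trans hc hray h2).trans hc hray B
    convert this using 2 with w
    rw [Finset.sum_insert hmT, branchJump]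
    ring

/-- A loop that passes through `z` only at its end points. -/
lemma logAsymptotic_of_endpoints (hc : ContDiff ℝ 1 c) (hst : s < t)
    (hc' : ∀ τ, deriv c τ ≠ 0) (hfin : G.Finite)
    (hray : ∀ w ∈ G, ∀ᶠ r : ℝ in 𝓝[>] 0, ∀ τ, c τ ≠ z + r * w) (hs : c s = z) (ht : c t = z)
    (hall : ∀ τ ∈ Ioo s t, c τ ≠ z) (hGs : ∀ w ∈ G, (w / deriv c s).im ≠ 0)
    (hGt : ∀ w ∈ G, (w / deriv c t).im ≠ 0) :
    LogAsymptotic c s t z G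
      fun w => Complex.log (w / deriv c t) - Complex.log (-w / deriv c s) := by
  have e1 := eventually_logAsymptotic_right hc hs (hc' s) hfin hGs
  have e2 := eventually_logAsymptotic_left hc ht (hc' t) hfin hGt
  have e3 : ∀ᶠ δ in 𝓝[>] (0 : ℝ), δ ∈ Ioo 0 ((t - s) / 2) := Ioo_mem_nhdsGT (by linarith)
  obtain ⟨δ, h1, h2, h3⟩ := (e1.and (e2.and e3)).exists
  have B : LogAsymptotic c (s + δ) (t - δ) z G fun _ => 0 :=
    LogAsymptotic.of_forall_ne hc (by linarith [h3.2]) fun τ hτ =>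
      hall τ ⟨by linarith [hτ.1, h3.1], by linarith [hτ.2, h3.1]⟩
  convert (h1.trans hc hray B).trans hc hray h2 using 2 with w
  ring

end LogAsymptotic

/-! ### Identities for the principal logarithm. -/

section LogIdentities

lemma log_neg_of_im_ne_zero {u : ℂ} (hu : u.im ≠ 0) :
    Complex.log (-u) = Complex.log u - SignType.sign u.im * (Real.pi * Complex.I) := by
  rcases lt_or_gt_of_ne hu with h | h
  · rw [Complex.log, Complex.log, Complex.arg_neg_eq_arg_add_pi_of_im_neg h, norm_neg,
      sign_neg h, SignType.coe_neg_one]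
    push_cast; ring
  · rw [Complex.log, Complex.log, Complex.arg_neg_eq_arg_sub_pi_of_im_pos h, norm_neg,
      sign_pos h]
    push_cast [SignType.coe_one]; ring

lemma branchJump_eq {h w : ℂ} (hw : (w / h).im ≠ 0) :
    branchJump h w = SignType.sign (w / h).im * (Real.pi * Complex.I) := by
  rw [branchJump, neg_div, log_neg_of_im_ne_zero hw]
  ring

/-- The arguments lie in `[0, π]` and `(-π, 0)`, so their sum stays in the principal range. -/
lemma log_mul_of_im_pos_of_im_neg {u v : ℂ} (hu : 0 < u.im) (hv : v.im < 0) :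
    Complex.log (u * v) = Complex.log u + Complex.log v := by
  have hu0 : u ≠ 0 := fun e => by simp [e] at hu
  have hv0 : v ≠ 0 := fun e => by simp [e] at hv
  refine Complex.log_mul hu0 hv0 ⟨?_, ?_⟩
  · have h1 := Complex.neg_pi_lt_arg v
    have h2 := Complex.arg_nonneg_iff.2 hu.le
    linarith
  · have h1 := Complex.arg_le_pi u
    have h2 := Complex.arg_neg_iff.2 hv
    linarith

lemma log_mul_of_im_mul_neg {u v : ℂ} (h : u.im * v.im < 0) :
    Complex.log (u * v) = Complex.log u + Complex.log v := by
  rcases mul_neg_iff.1 h with ⟨hu, hv⟩ | ⟨hu, hv⟩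
  · exact log_mul_of_im_pos_of_im_neg hu hv
  · rw [mul_comm, log_mul_of_im_pos_of_im_neg hv hu, add_comm]

lemma im_inv_mul_im_neg {z : ℂ} (hz : z.im ≠ 0) : z.im * (z⁻¹).im < 0 := by
  rw [Complex.inv_im]
  have h0 : z ≠ 0 := fun e => by simp [e] at hz
  have : 0 < Complex.normSq z := Complex.normSq_pos.2 h0
  have h2 : 0 < z.im ^ 2 := by positivity
  have : z.im * (-z.im / Complex.normSq z) = -(z.im ^ 2 / Complex.normSq z) := by ring
  rw [this]
  have := div_pos h2 ‹0 < Complex.normSq z›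
  linarith

/-- The alternating sum over the four corners of the jump function of a loop based at the
crossing. -/
lemma alternating_sum_loop {a b : ℂ} (ha : a ≠ 0) (hb : b ≠ 0) (hab : (a / b).im ≠ 0)
    {g : ℂ → ℂ} (hg : ∀ w, g w = Complex.log (w / b) - Complex.log (-w / a)) :
    g (a + b) - g (a - b) - g (-a + b) + g (-a - b)
      = SignType.sign (b / a).im * (2 * Real.pi * Complex.I) := by
  set z := a / b with hz
  have hba : b / a = z⁻¹ := by rw [hz, inv_div]
  have hneg := im_inv_mul_im_neg hab
  have hzi : (z⁻¹).im ≠ 0 := fun e => by simp [e] at hneg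
  have hz0 : z ≠ 0 := div_ne_zero ha hb
  -- Divided by `b` and by `a`, the corners become `±z ± 1` and `±1 ± z⁻¹`. As `z` and `z⁻¹` lie in
  -- opposite half planes, logarithms of the relevant products are additive. All logarithms then
  -- cancel, leaving only the corrections by `π * I` from `log_neg_of_im_ne_zero`.
  have e1 : (a + b) / b = z + 1 := by rw [hz]; field_simp
  have e2 : (a - b) / b = z - 1 := by rw [hz]; field_simp
  have e3 : (-a + b) / b = -(z - 1) := by rw [hz]; field_simp; ring
  have e4 : (-a - b) / b = -(z + 1) := by rw [hz]; field_simp; ring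
  have f1 : -(a + b) / a = -(1 + z⁻¹) := by rw [← hba]; field_simp
  have f2 : -(a - b) / a = -(1 - z⁻¹) := by rw [← hba]; field_simp
  have f3 : -(-a + b) / a = 1 - z⁻¹ := by rw [← hba]; field_simp; ring
  have f4 : -(-a - b) / a = 1 + z⁻¹ := by rw [← hba]; field_simp; ring
  have l1 := log_neg_of_im_ne_zero (u := z + 1) (by simpa using hab)
  have l2 := log_neg_of_im_ne_zero (u := z - 1) (by simpa using hab)
  have l3 := log_neg_of_im_ne_zero (u := 1 + z⁻¹) (by simpa using hzi)
  have l4 := log_neg_of_im_ne_zero (u := 1 - z⁻¹) (by simpa using hzi)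
  have k1 : Complex.log (z + 1) = Complex.log z + Complex.log (1 + z⁻¹) := by
    rw [← log_mul_of_im_mul_neg (by simpa using hneg), mul_add, mul_one, mul_inv_cancel₀ hz0]
  have k2 : Complex.log (1 - z⁻¹) = Complex.log (z - 1) + Complex.log z⁻¹ := by
    rw [← log_mul_of_im_mul_neg (by simpa using hneg), sub_mul, one_mul, mul_inv_cancel₀ hz0]
  have k3 : Complex.log z⁻¹ = -Complex.log z :=
    Complex.log_inv _ fun e => hab (Complex.arg_eq_pi_iff.1 e).2
  have s1 : (z + 1).im = z.im := by simp
  have s2 : (z - 1).im = z.im := by simp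
  have s3 : (1 + z⁻¹).im = (z⁻¹).im := by simp
  have s4 : (1 - z⁻¹).im = -(z⁻¹).im := by simp
  rw [s1] at l1
  rw [s2] at l2
  rw [s3] at l3
  rw [s4, Left.sign_neg] at l4
  rw [hg, hg, hg, hg, e1, e2, e3, e4, f1, f2, f3, f4, l1, l2, l3, l4, hba, k2, k1, k3]
  push_cast
  ring

end LogIdentities

/-! ### Sums over signs and local injectivity. -/

lemma sum_units {M : Type*} [AddCommMonoid M] (f : ℤˣ → ℤˣ → M) :
    ∑ s, ∑ t, f s t = f 1 1 + f 1 (-1) + (f (-1) 1 + f (-1) (-1)) := by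
  rw [UnitsInt.univ]
  simp

/-- A strictly differentiable map with an injective derivative is locally injective. -/
lemma HasStrictFDerivAt.eventually_injective {V F : Type*} [NormedAddCommGroup V]
    [NormedSpace ℝ V] [FiniteDimensional ℝ V] [NormedAddCommGroup F] [NormedSpace ℝ F] {f : V → F}
    {L : V →L[ℝ] F} {x : V} (hf : HasStrictFDerivAt f L x) (hL : Function.Injective L) :
    ∀ᶠ p : V × V in 𝓝 (x, x), f p.1 = f p.2 → p.1 = p.2 := by
  obtain ⟨K, hK, hanti⟩ := L.toLinearMap.exists_antilipschitzWith (LinearMap.ker_eq_bot.2 hL)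
  have hK' : (0 : ℝ) < K := hK
  filter_upwards [hf.isLittleO.def (c := (2 * K : ℝ)⁻¹) (by positivity)] with p hp he
  rw [he, sub_self, zero_sub, norm_neg] at hp
  have h1 := hanti.le_mul_norm (map_zero _) (p.1 - p.2)
  have h2 : ‖p.1 - p.2‖ ≤ K * ((2 * K : ℝ)⁻¹ * ‖p.1 - p.2‖) :=
    h1.trans (mul_le_mul_of_nonneg_left hp hK'.le)
  have h3 : K * ((2 * K : ℝ)⁻¹ * ‖p.1 - p.2‖) = ‖p.1 - p.2‖ / 2 := by field_simp
  have h4 := norm_nonneg (p.1 - p.2)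
  exact sub_eq_zero.1 (norm_eq_zero.1 (by linarith))

lemma exists_units {p : ℤˣ → Prop} : (∃ s, p s) ↔ p 1 ∨ p (-1) := by
  refine ⟨?_, fun h => h.elim (fun h => ⟨_, h⟩) fun h => ⟨_, h⟩⟩
  rintro ⟨s, h⟩
  rcases Int.units_eq_one_or s with rfl | rfl
  exacts [Or.inl h, Or.inr h]

/-! ### Regions, planar charts and branches at a crossing. -/

namespace LinkProjection

variable {E : Type} [NormedAddCommGroup E] [NormedSpace ℝ E] {S : Set E} {D : LinkProjection S}

lemma Region.subset (R : D.Region) : R.1 ⊆ S \ D.image := by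
  obtain ⟨R, p, hp, rfl⟩ := R
  exact connectedComponentIn_subset _ _

lemma Region.isPreconnected (R : D.Region) : IsPreconnected R.1 := by
  obtain ⟨R, p, hp, rfl⟩ := R
  exact isPreconnected_connectedComponentIn

lemma Region.nonempty (R : D.Region) : R.1.Nonempty := by
  obtain ⟨R, p, hp, rfl⟩ := R
  exact ⟨p, mem_connectedComponentIn hp⟩

lemma Region.eq_of_mem {R R' : D.Region} {p : E} (h : p ∈ R.1) (h' : p ∈ R'.1) : R = R' := by
  obtain ⟨R, q, hq, rfl⟩ := R
  obtain ⟨R', q', hq', rfl⟩ := R'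
  exact Subtype.ext ((connectedComponentIn_eq h).trans (connectedComponentIn_eq h').symm)

lemma exists_region_of_isPreconnected {K : Set E} (hK : IsPreconnected K) (hne : K.Nonempty)
    (hsub : K ⊆ S \ D.image) : ∃ R : D.Region, K ⊆ R.1 := by
  obtain ⟨p, hp⟩ := hne
  exact ⟨⟨_, p, hsub hp, rfl⟩, hK.subset_connectedComponentIn hp hsub⟩

lemma contDiff_curve (D : LinkProjection S) (i : Fin D.l) : ContDiff ℝ 1 (D.curve i) :=
  (D.smooth i).of_le (by exact_mod_cast le_top)

lemma mem_image (D : LinkProjection S) (i : Fin D.l) (t : ℝ) : D.curve i t ∈ D.image :=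
  ⟨i, t, rfl⟩

/-- A smooth parametrization `ψ` of a part `S ∩ U` of the surface that contains the projection
image by the complex plane, with the inverse `φ`. -/
structure PlanarChart (D : LinkProjection S) where
  U : Set E
  φ : E → ℂ
  ψ : ℂ → E
  isOpen_U : IsOpen U
  contDiffOn_φ : ContDiffOn ℝ 1 φ U
  contDiff_ψ : ContDiff ℝ 1 ψ
  ψ_mem : ∀ z, ψ z ∈ S ∩ U
  φ_ψ : ∀ z, φ (ψ z) = z
  ψ_φ : ∀ p ∈ S ∩ U, ψ (φ p) = p
  image_subset : D.image ⊆ U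

namespace PlanarChart

variable (P : D.PlanarChart)

/-- The components of the link projection in a planar chart. -/
def curve (i : Fin D.l) (t : ℝ) : ℂ := P.φ (D.curve i t)

lemma curve_mem (i : Fin D.l) (t : ℝ) : D.curve i t ∈ S ∩ P.U :=
  ⟨D.mem_surface i t, P.image_subset (D.mem_image i t)⟩

lemma ψ_curve (i : Fin D.l) (t : ℝ) : P.ψ (P.curve i t) = D.curve i t :=
  P.ψ_φ _ (P.curve_mem i t)

lemma curve_eq_iff {i j : Fin D.l} {s t : ℝ} :
    P.curve i s = P.curve j t ↔ D.curve i s = D.curve j t :=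
  ⟨fun h => by rw [← P.ψ_curve, h, P.ψ_curve], fun h => by rw [curve, h, curve]⟩

lemma curve_eq_φ_iff {i : Fin D.l} {t : ℝ} {y : E} (hy : y ∈ D.image) :
    P.curve i t = P.φ y ↔ D.curve i t = y := by
  obtain ⟨j, s, rfl⟩ := hy
  exact P.curve_eq_iff

lemma ψ_mem_image_iff {z : ℂ} : P.ψ z ∈ D.image ↔ ∃ i t, P.curve i t = z :=
  ⟨fun ⟨i, t, h⟩ => ⟨i, t, by rw [curve, h, P.φ_ψ]⟩,
    fun ⟨i, t, h⟩ => ⟨i, t, by rw [← h, P.ψ_curve]⟩⟩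

lemma contDiff_curve (i : Fin D.l) : ContDiff ℝ 1 (P.curve i) :=
  P.contDiffOn_φ.comp_contDiff (D.contDiff_curve i) fun t => (P.curve_mem i t).2

/-- The derivative of `ψ` carries chart velocities to the original ones, so immersedness and
transversality are inherited by the chart: a linear relation there would persist in `E`. -/
lemma deriv_curve (i : Fin D.l) (t : ℝ) :
    deriv (D.curve i) t = fderiv ℝ P.ψ (P.curve i t) (deriv (P.curve i) t) := by
  have h1 := hasDerivAt_of_contDiff_one (P.contDiff_curve i) t
  have h2 : HasFDerivAt P.ψ (fderiv ℝ P.ψ (P.curve i t)) (P.curve i t) :=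
    (P.contDiff_ψ.differentiable one_ne_zero _).hasFDerivAt
  have h3 := (h2.comp_hasDerivAt t h1).deriv
  rw [← h3]
  congr 1
  ext τ
  exact (P.ψ_curve i τ).symm

lemma deriv_curve_ne_zero (i : Fin D.l) (t : ℝ) : deriv (P.curve i) t ≠ 0 := fun h =>
  D.immersed i t (by rw [P.deriv_curve, h, map_zero])

lemma periodic_curve (i : Fin D.l) : Function.Periodic (P.curve i) 1 := fun t => by
  rw [curve, D.periodic i t, curve]

lemma continuousAt_φ {p : E} (hp : p ∈ P.U) : ContinuousAt P.φ p :=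
  P.contDiffOn_φ.continuousOn.continuousAt (P.isOpen_U.mem_nhds hp)

end PlanarChart

/-- The two branches through a crossing. -/
structure Branches (D : LinkProjection S) (y : E) where
  i₁ : Fin D.l
  t₁ : ℝ
  i₂ : Fin D.l
  t₂ : ℝ
  hit₁ : D.curve i₁ t₁ = y
  hit₂ : D.curve i₂ t₂ = y
  indep : LinearIndependent ℝ ![deriv (D.curve i₁) t₁, deriv (D.curve i₂) t₂]
  all : ∀ k τ, D.curve k τ = y → ∃ m : ℤ, (k = i₁ ∧ τ = t₁ + m) ∨ (k = i₂ ∧ τ = t₂ + m)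

namespace Branches

variable {y : E} (B : D.Branches y)

/-- The corners at the crossing. -/
noncomputable def corner (s t : ℤˣ) : E :=
  ((s : ℤ) : ℝ) • deriv (D.curve B.i₁) B.t₁ + ((t : ℤ) : ℝ) • deriv (D.curve B.i₂) B.t₂

/-- The velocity of the first branch in a planar chart. -/
noncomputable def vel₁ (P : D.PlanarChart) : ℂ := deriv (P.curve B.i₁) B.t₁

/-- The velocity of the second branch in a planar chart. -/
noncomputable def vel₂ (P : D.PlanarChart) : ℂ := deriv (P.curve B.i₂) B.t₂

/-- The corners at the crossing in a planar chart. -/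
noncomputable def dir (P : D.PlanarChart) (s t : ℤˣ) : ℂ :=
  ((s : ℤ) : ℝ) • B.vel₁ P + ((t : ℤ) : ℝ) • B.vel₂ P

lemma mem_image {D : LinkProjection S} {y : E} (B : D.Branches y) : y ∈ D.image := ⟨_, _, B.hit₁⟩

lemma curve_hit₁ (P : D.PlanarChart) : P.curve B.i₁ B.t₁ = P.φ y := by
  rw [PlanarChart.curve, B.hit₁]

lemma curve_hit₂ (P : D.PlanarChart) : P.curve B.i₂ B.t₂ = P.φ y := by
  rw [PlanarChart.curve, B.hit₂]

lemma ψ_φ {y : E} (B : D.Branches y) (P : D.PlanarChart) : P.ψ (P.φ y) = y := by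
  rw [← B.curve_hit₁, P.ψ_curve, B.hit₁]

lemma fderiv_dir (P : D.PlanarChart) (s t : ℤˣ) :
    fderiv ℝ P.ψ (P.φ y) (B.dir P s t) = B.corner s t := by
  rw [dir, corner, P.deriv_curve, P.deriv_curve, map_add, map_smul, map_smul, B.curve_hit₁,
    B.curve_hit₂, vel₁, vel₂]

lemma indep_vel (P : D.PlanarChart) : LinearIndependent ℝ ![B.vel₁ P, B.vel₂ P] := by
  refine LinearIndependent.of_comp (fderiv ℝ P.ψ (P.φ y)).toLinearMap ?_
  have h := B.indep
  rw [P.deriv_curve, P.deriv_curve, B.curve_hit₁, B.curve_hit₂] at h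
  convert h using 1
  ext i
  fin_cases i <;> rfl

end Branches

/-! ### The four sectors at a crossing. -/

lemma eventually_pos_of_hasDerivWithinAt {f : ℝ → ℝ} {k : ℝ} (h0 : f 0 = 0)
    (hf : HasDerivWithinAt f k (Ioi 0) 0) (hk : 0 < k) : ∀ᶠ r in 𝓝[>] (0 : ℝ), 0 < f r := by
  rw [hasDerivWithinAt_iff_tendsto_slope' (by simp)] at hf
  filter_upwards [hf.eventually_const_lt hk, self_mem_nhdsWithin] with r hr hr0
  have hr0' : (0 : ℝ) < r := hr0
  rw [slope_def_field, h0, sub_zero, sub_zero] at hr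
  exact (div_pos_iff_of_pos_right hr0').1 hr

lemma exists_unit_mul_pos {x : ℝ} (hx : x ≠ 0) : ∃ s : ℤˣ, 0 < ((s : ℤ) : ℝ) * x := by
  rcases lt_or_gt_of_ne hx with h | h
  · exact ⟨-1, by simpa using h⟩
  · exact ⟨1, by simpa using h⟩

lemma unit_mul_self (s : ℤˣ) : ((s : ℤ) : ℝ) * ((s : ℤ) : ℝ) = 1 := by
  rcases Int.units_eq_one_or s with rfl | rfl <;> simp

/-- Near a crossing, the surface is divided into four sectors by the two branches. -/
lemma Branches.exists_cornerRegion (P : D.PlanarChart) {y : E} (B : D.Branches y) :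
    ∃ R : ℤˣ → ℤˣ → D.Region,
      (∀ s t (d : ℝ → ℂ), d 0 = P.φ y → HasDerivWithinAt d (B.dir P s t) (Ioi 0) 0 →
        ∀ᶠ r in 𝓝[>] (0 : ℝ), P.ψ (d r) ∈ (R s t).1) ∧
      ∀ R' : D.Region, y ∈ closure R'.1 → ∃ s t, R' = R s t := by
  set a := B.vel₁ P with ha
  set b := B.vel₂ P with hb
  have hind : LinearIndependent ℝ ![a, b] := B.indep_vel P
  -- Local coordinates in which the two branches are the coordinate axes: `H` restricts to one
  -- branch on each axis, and its derivative is invertible by transversality.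
  set H : ℝ × ℝ → ℂ := fun q =>
    P.curve B.i₁ (B.t₁ + q.1) + P.curve B.i₂ (B.t₂ + q.2) - P.φ y with hH
  have hHc : ContDiff ℝ 1 H := by
    have h1 := P.contDiff_curve B.i₁
    have h2 := P.contDiff_curve B.i₂
    exact ((h1.comp (contDiff_const.add contDiff_fst)).add
      (h2.comp (contDiff_const.add contDiff_snd))).sub contDiff_const
  have hH0 : H 0 = P.φ y := by
    simp [hH, B.curve_hit₁, B.curve_hit₂]
  have hH1 : ∀ q : ℝ × ℝ, q.2 = 0 → H q = P.curve B.i₁ (B.t₁ + q.1) := by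
    intro q h
    simp [hH, h, B.curve_hit₂]
  have hH2 : ∀ q : ℝ × ℝ, q.1 = 0 → H q = P.curve B.i₂ (B.t₂ + q.2) := by
    intro q h
    simp [hH, h, B.curve_hit₁]
  set L : ℝ × ℝ →L[ℝ] ℂ := (ContinuousLinearMap.fst ℝ ℝ ℝ).smulRight a
    + (ContinuousLinearMap.snd ℝ ℝ ℝ).smulRight b with hL
  have hLa : ∀ q, L q = q.1 • a + q.2 • b := fun q => by simp [hL]
  have hLinj : Function.Injective L := by
    refine (injective_iff_map_eq_zero L).2 fun q hq => ?_
    rw [hLa] at hq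
    have := LinearIndependent.pair_iff.1 hind _ _ hq
    exact Prod.ext this.1 this.2
  set e : (ℝ × ℝ) ≃L[ℝ] ℂ := (LinearEquiv.ofInjectiveOfFinrankEq L.toLinearMap hLinj
    (by simp)).toContinuousLinearEquiv with he
  have heL : (e : ℝ × ℝ →L[ℝ] ℂ) = L := by
    ext <;> rfl
  have hstrict : HasStrictFDerivAt H (e : ℝ × ℝ →L[ℝ] ℂ) 0 := by
    refine hHc.contDiffAt.hasStrictFDerivAt' ?_ one_ne_zero
    rw [heL]
    have h1 : HasDerivAt (P.curve B.i₁) a (B.t₁ + (0 : ℝ × ℝ).1) := by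
      rw [Prod.fst_zero, add_zero]
      exact hasDerivAt_of_contDiff_one (P.contDiff_curve B.i₁) B.t₁
    have h2 : HasDerivAt (P.curve B.i₂) b (B.t₂ + (0 : ℝ × ℝ).2) := by
      rw [Prod.snd_zero, add_zero]
      exact hasDerivAt_of_contDiff_one (P.contDiff_curve B.i₂) B.t₂
    have k1 : HasFDerivAt (fun q : ℝ × ℝ => B.t₁ + q.1) (ContinuousLinearMap.fst ℝ ℝ ℝ) 0 :=
      hasFDerivAt_fst.const_add _
    have k2 : HasFDerivAt (fun q : ℝ × ℝ => B.t₂ + q.2) (ContinuousLinearMap.snd ℝ ℝ ℝ) 0 :=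
      hasFDerivAt_snd.const_add _
    have := ((h1.hasFDerivAt.comp (0 : ℝ × ℝ) k1).add
      (h2.hasFDerivAt.comp (0 : ℝ × ℝ) k2)).sub_const (P.φ y)
    refine this.congr_fderiv ?_
    ext <;> simp [hL]
  set O := hstrict.toOpenPartialHomeomorph H with hO
  have hOcoe : ∀ q, O q = H q := fun q => rfl
  have h0s : (0 : ℝ × ℝ) ∈ O.source := hstrict.mem_toOpenPartialHomeomorph_source
  have hsrc : O.source ∈ 𝓝 (0 : ℝ × ℝ) := O.open_source.mem_nhds h0s
  have hsymm0 : O.symm (P.φ y) = 0 := by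
    rw [← hH0, ← hOcoe, O.left_inv h0s]
  have htgt : O.target ∈ 𝓝 (P.φ y) := by
    have := hstrict.image_mem_toOpenPartialHomeomorph_target
    rw [hH0] at this
    exact O.open_target.mem_nhds this
  -- Near the crossing the image is contained in the axes. By compactness of a period it suffices to
  -- look near one time `τ`: if the curve is at the crossing then, it runs along an axis and `H` is
  -- injective; otherwise it stays away.
  have haxes : ∀ᶠ q in 𝓝 (0 : ℝ × ℝ), ∀ j : Fin D.l, ∀ τ ∈ Icc (0 : ℝ) 1,
      P.curve j τ = H q → q.1 = 0 ∨ q.2 = 0 := by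
    refine eventually_all.2 fun j => isCompact_Icc.eventually_forall_of_forall_eventually ?_
    intro τ _
    by_cases hτ : P.curve j τ = P.φ y
    · obtain ⟨m, ⟨rfl, hm⟩ | ⟨rfl, hm⟩⟩ := B.all j τ ((P.curve_eq_φ_iff B.mem_image).1 hτ)
      · have hin : ∀ᶠ x : (ℝ × ℝ) × ℝ in 𝓝 (0, τ), ((x.2 - τ, 0) : ℝ × ℝ) ∈ O.source := by
          have : ContinuousAt (fun x : (ℝ × ℝ) × ℝ => ((x.2 - τ, 0) : ℝ × ℝ)) (0, τ) := by
            fun_prop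
          exact this.eventually_mem (by simp only [sub_self]; exact hsrc)
        have hin' : ∀ᶠ x : (ℝ × ℝ) × ℝ in 𝓝 (0, τ), x.1 ∈ O.source :=
          continuousAt_fst.eventually_mem hsrc
        filter_upwards [hin, hin'] with x hx hx' hxe
        right
        have h1 : H (x.2 - τ, 0) = H x.1 := by
          rw [hH1 _ rfl, ← hxe, ← (P.periodic_curve _).int_mul m]
          congr 1
          simp only
          rw [hm]; ring
        have := O.injOn hx hx' h1
        rw [← this]
      · have hin : ∀ᶠ x : (ℝ × ℝ) × ℝ in 𝓝 (0, τ), ((0, x.2 - τ) : ℝ × ℝ) ∈ O.source := by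
          have : ContinuousAt (fun x : (ℝ × ℝ) × ℝ => ((0, x.2 - τ) : ℝ × ℝ)) (0, τ) := by
            fun_prop
          exact this.eventually_mem (by simp only [sub_self]; exact hsrc)
        have hin' : ∀ᶠ x : (ℝ × ℝ) × ℝ in 𝓝 (0, τ), x.1 ∈ O.source :=
          continuousAt_fst.eventually_mem hsrc
        filter_upwards [hin, hin'] with x hx hx' hxe
        left
        have h1 : H (0, x.2 - τ) = H x.1 := by
          rw [hH2 _ rfl, ← hxe, ← (P.periodic_curve _).int_mul m]
          congr 1
          simp only
          rw [hm]; ring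
        have := O.injOn hx hx' h1
        rw [← this]
    · have hc1 : ContinuousAt (fun x : (ℝ × ℝ) × ℝ => P.curve j x.2) (0, τ) :=
        ((P.contDiff_curve j).continuous.comp continuous_snd).continuousAt
      have hc2 : ContinuousAt (fun x : (ℝ × ℝ) × ℝ => H x.1) (0, τ) :=
        (hHc.continuous.comp continuous_fst).continuousAt
      have hne : (fun x : (ℝ × ℝ) × ℝ => P.curve j x.2) (0, τ)
          ≠ (fun x : (ℝ × ℝ) × ℝ => H x.1) (0, τ) := by
        simpa [hH0] using hτ
      filter_upwards [(hc1.sub hc2).eventually_ne (sub_ne_zero.2 hne)] with x hx hxe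
      exact absurd (sub_eq_zero.2 hxe) hx
  obtain ⟨ε, hε, hball⟩ := Metric.eventually_nhds_iff_ball.1 (haxes.and hsrc)
  have haxes' : ∀ q ∈ Metric.ball (0 : ℝ × ℝ) ε, P.ψ (H q) ∈ D.image → q.1 = 0 ∨ q.2 = 0 := by
    intro q hq him
    obtain ⟨j, τ, hτ⟩ := P.ψ_mem_image_iff.1 him
    refine (hball q hq).1 j (Int.fract τ) ⟨Int.fract_nonneg _, (Int.fract_lt_one _).le⟩ ?_
    rw [← hτ, ← (P.periodic_curve j).int_mul ⌊τ⌋ (Int.fract τ), mul_one, Int.fract_add_floor]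
  -- The open quadrants of a small ball are convex and miss the axes, so each is mapped into a
  -- single region.
  set Q : ℤˣ → ℤˣ → Set (ℝ × ℝ) := fun s t =>
    Metric.ball 0 ε ∩ ({q | 0 < ((s : ℤ) : ℝ) * q.1} ∩ {q | 0 < ((t : ℤ) : ℝ) * q.2}) with hQ
  have hQconv : ∀ s t, Convex ℝ (Q s t) := by
    intro s t
    refine (convex_ball _ _).inter (Convex.inter ?_ ?_)
    · exact convex_halfSpace_gt
        (((s : ℤ) : ℝ) • LinearMap.fst ℝ ℝ ℝ : ℝ × ℝ →ₗ[ℝ] ℝ).isLinear 0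
    · exact convex_halfSpace_gt
        (((t : ℤ) : ℝ) • LinearMap.snd ℝ ℝ ℝ : ℝ × ℝ →ₗ[ℝ] ℝ).isLinear 0
  have hQne : ∀ s t, (Q s t).Nonempty := by
    intro s t
    refine ⟨(((s : ℤ) : ℝ) * (ε / 2), ((t : ℤ) : ℝ) * (ε / 2)), ?_, ?_, ?_⟩
    · rw [mem_ball_zero_iff, Prod.norm_def, max_lt_iff]
      have hs : |((s : ℤ) : ℝ)| = 1 := by
        rcases Int.units_eq_one_or s with rfl | rfl <;> simp
      have ht : |((t : ℤ) : ℝ)| = 1 := by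
        rcases Int.units_eq_one_or t with rfl | rfl <;> simp
      simp only [norm_mul, Real.norm_eq_abs, hs, ht, abs_of_pos (half_pos hε)]
      constructor <;> linarith
    · simp only [mem_ofPred_eq]
      rw [← mul_assoc, unit_mul_self]
      linarith
    · simp only [mem_ofPred_eq]
      rw [← mul_assoc, unit_mul_self]
      linarith
  have hreg : ∀ s t, ∃ R : D.Region, (fun q => P.ψ (H q)) '' Q s t ⊆ R.1 := by
    intro s t
    refine exists_region_of_isPreconnected ((hQconv s t).isPreconnected.image _
      (P.contDiff_ψ.continuous.comp hHc.continuous).continuousOn) ((hQne s t).image _) ?_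
    rintro _ ⟨q, hq, rfl⟩
    refine ⟨(P.ψ_mem _).1, fun him => ?_⟩
    rcases haxes' q hq.1 him with h | h
    · have := hq.2.1
      simp [h] at this
    · have := hq.2.2
      simp [h] at this
  choose R hR using hreg
  have hsymmc : ContinuousAt O.symm (P.φ y) :=
    O.continuousAt_symm (mem_of_mem_nhds htgt)
  have hnear : ∀ᶠ z in 𝓝 (P.φ y), O.symm z ∈ Metric.ball (0 : ℝ × ℝ) ε ∧ H (O.symm z) = z := by
    have h1 : ∀ᶠ z in 𝓝 (P.φ y), O.symm z ∈ Metric.ball (0 : ℝ × ℝ) ε :=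
      hsymmc.eventually_mem (by rw [hsymm0]; exact Metric.ball_mem_nhds _ hε)
    filter_upwards [h1, htgt] with z hz hz'
    exact ⟨hz, O.right_inv hz'⟩
  refine ⟨R, ?_, ?_⟩
  · intro s t d hd0 hd
    have hinv : HasFDerivAt O.symm (e.symm : ℂ →L[ℝ] ℝ × ℝ) (d 0) := by
      rw [hd0, ← hH0]
      exact hstrict.to_localInverse.hasFDerivAt
    have hq := hinv.comp_hasDerivWithinAt 0 hd
    -- In the coordinates of `H` the corner direction is `(s, t)`, so a curve leaving in it enters
    -- the quadrant with these signs.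
    have hdir : e.symm (B.dir P s t) = (((s : ℤ) : ℝ), ((t : ℤ) : ℝ)) := by
      rw [e.symm_apply_eq]
      change B.dir P s t = (e : ℝ × ℝ →L[ℝ] ℂ) _
      rw [heL, hLa]
      rfl
    have hq' : HasDerivWithinAt (O.symm ∘ d) (((s : ℤ) : ℝ), ((t : ℤ) : ℝ)) (Ioi 0) 0 := by
      rw [← hdir]; exact hq
    have hq0 : O.symm (d 0) = 0 := by rw [hd0, hsymm0]
    have p1 : ∀ᶠ r in 𝓝[>] (0 : ℝ), 0 < ((s : ℤ) : ℝ) * (O.symm (d r)).1 := by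
      refine eventually_pos_of_hasDerivWithinAt (k := ((s : ℤ) : ℝ) * ((s : ℤ) : ℝ))
        (by simp [hq0]) ?_ (by rw [unit_mul_self]; exact one_pos)
      exact ((hasFDerivAt_fst (p := (O.symm ∘ d) 0)).comp_hasDerivWithinAt 0 hq').const_mul _
    have p2 : ∀ᶠ r in 𝓝[>] (0 : ℝ), 0 < ((t : ℤ) : ℝ) * (O.symm (d r)).2 := by
      refine eventually_pos_of_hasDerivWithinAt (k := ((t : ℤ) : ℝ) * ((t : ℤ) : ℝ))
        (by simp [hq0]) ?_ (by rw [unit_mul_self]; exact one_pos)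
      exact ((hasFDerivAt_snd (p := (O.symm ∘ d) 0)).comp_hasDerivWithinAt 0 hq').const_mul _
    have hdt : Tendsto d (𝓝[>] 0) (𝓝 (P.φ y)) := by
      rw [← hd0]; exact hd.continuousWithinAt
    filter_upwards [p1, p2, hdt.eventually hnear] with r h1 h2 h3
    exact hR s t ⟨O.symm (d r), ⟨h3.1, h1, h2⟩, congrArg P.ψ h3.2⟩
  · intro R' hR'
    have hyU : y ∈ P.U := P.image_subset B.mem_image
    have h1 : ∀ᶠ p in 𝓝 y, O.symm (P.φ p) ∈ Metric.ball (0 : ℝ × ℝ) ε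
        ∧ H (O.symm (P.φ p)) = P.φ p := (P.continuousAt_φ hyU).tendsto.eventually hnear
    obtain ⟨p, hpR, ⟨hq1, hq2⟩, hpU⟩ := ((mem_closure_iff_frequently.1 hR').and_eventually
      (h1.and (P.isOpen_U.mem_nhds hyU))).exists
    obtain ⟨hpS, hpi⟩ := R'.subset hpR
    set q := O.symm (P.φ p)
    have hψ : P.ψ (H q) = p := by rw [hq2, P.ψ_φ p ⟨hpS, hpU⟩]
    have hn1 : q.1 ≠ 0 := fun h => hpi (by
      rw [← hψ, hH2 q h, P.ψ_curve]; exact D.mem_image _ _)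
    have hn2 : q.2 ≠ 0 := fun h => hpi (by
      rw [← hψ, hH1 q h, P.ψ_curve]; exact D.mem_image _ _)
    obtain ⟨s, hs⟩ := exists_unit_mul_pos hn1
    obtain ⟨t, ht⟩ := exists_unit_mul_pos hn2
    exact ⟨s, t, Region.eq_of_mem hpR (hR s t ⟨q, ⟨hq1, hs, ht⟩, hψ⟩)⟩

/-! ### Winding numbers as functions on the regions. -/

/-- The only delicate points are those outside the chart, where the value is set to zero: near them
the chart coordinate leaves every compact set, and the integral vanishes at infinity. -/
lemma PlanarChart.continuousOn_indicator_logInt (P : D.PlanarChart) (i : Fin D.l) {s t : ℝ}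
    (hst : s ≤ t) :
    ContinuousOn (P.U.indicator fun p => logInt (P.curve i) s t (P.φ p)) (S \ D.image) := by
  intro p hp
  by_cases hpU : p ∈ P.U
  · refine ContinuousAt.continuousWithinAt ?_
    have hne : ∀ τ ∈ Icc s t, P.curve i τ ≠ P.φ p := fun τ _ h => hp.2 (by
      rw [← P.ψ_φ p ⟨hp.1, hpU⟩]; exact P.ψ_mem_image_iff.2 ⟨i, τ, h⟩)
    have h1 : ContinuousAt (fun p => logInt (P.curve i) s t (P.φ p)) p :=
      ContinuousAt.comp (continuousAt_logInt (P.contDiff_curve i) hst hne) (P.continuousAt_φ hpU)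
    refine h1.congr ?_
    filter_upwards [P.isOpen_U.mem_nhds hpU] with q hq
    rw [indicator_of_mem hq]
  · rw [ContinuousWithinAt, indicator_of_notMem hpU]
    intro N hN
    obtain ⟨K, hK, hKN⟩ := mem_cocompact.1 (tendsto_logInt_cocompact (P.contDiff_curve i) hst hN)
    have hcl : IsClosed (P.ψ '' K) := (hK.image P.contDiff_ψ.continuous).isClosed
    have hpK : p ∈ (P.ψ '' K)ᶜ := by
      rintro ⟨z, -, rfl⟩
      exact hpU (P.ψ_mem z).2
    rw [mem_map]
    filter_upwards [mem_nhdsWithin_of_mem_nhds (hcl.isOpen_compl.mem_nhds hpK),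
      self_mem_nhdsWithin] with q hq hqS
    by_cases hqU : q ∈ P.U
    · rw [mem_preimage, indicator_of_mem hqU]
      exact hKN fun h => hq ⟨_, h, P.ψ_φ q ⟨hqS.1, hqU⟩⟩
    · rw [mem_preimage, indicator_of_notMem hqU]
      exact mem_of_mem_nhds hN

/-- The winding number of a loop as a function on the regions. -/
lemma PlanarChart.exists_winding (P : D.PlanarChart) (i : Fin D.l) {s t : ℝ} (hst : s ≤ t)
    (hcl : D.curve i s = D.curve i t) :
    ∃ F : D.Region → ℤ, ∀ (R : D.Region) (z : ℂ), P.ψ z ∈ R.1 →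
      logInt (P.curve i) s t z = F R * (2 * Real.pi * Complex.I) := by
  set f := P.U.indicator fun p => logInt (P.curve i) s t (P.φ p) with hf
  have hpi : (2 * Real.pi * Complex.I) ≠ 0 := Complex.two_pi_I_ne_zero
  have hint : ∀ p ∈ S \ D.image, ∃ n : ℤ, f p = n * (2 * Real.pi * Complex.I) := by
    intro p hp
    by_cases hpU : p ∈ P.U
    · rw [hf, indicator_of_mem hpU]
      refine exists_logInt_eq_int_mul (P.contDiff_curve i) hst (fun τ _ h => hp.2 ?_)
        (P.curve_eq_iff.2 hcl)
      rw [← P.ψ_φ p ⟨hp.1, hpU⟩]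
      exact P.ψ_mem_image_iff.2 ⟨i, τ, h⟩
    · exact ⟨0, by rw [hf, indicator_of_notMem hpU]; simp⟩
  have hcont : ContinuousOn (fun p => (f p / (2 * Real.pi * Complex.I)).re) (S \ D.image) :=
    Complex.continuous_re.comp_continuousOn
      ((P.continuousOn_indicator_logInt i hst).div_const _)
  -- A continuous function with integer values is constant on the connected regions.
  have hdisc : DiscreteTopology (range ((↑) : ℤ → ℝ)) :=
    (Int.isClosedEmbedding_coe_real.isEmbedding.toHomeomorph).symm.isEmbedding.discreteTopology
  have hmaps : MapsTo (fun p => (f p / (2 * Real.pi * Complex.I)).re) (S \ D.image)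
      (range ((↑) : ℤ → ℝ)) := by
    intro p hp
    obtain ⟨n, hn⟩ := hint p hp
    exact ⟨n, by simp only [hn, mul_div_cancel_right₀ _ hpi, Complex.intCast_re]⟩
  choose p₀ hp₀ using fun R : D.Region => R.nonempty
  choose F hF using fun R : D.Region => hint (p₀ R) (R.subset (hp₀ R))
  refine ⟨F, fun R z hz => ?_⟩
  have hconst := R.isPreconnected.constant_of_mapsTo ⟨hdisc⟩ (hcont.mono R.subset)
    (fun p hp => hmaps (R.subset hp)) hz (hp₀ R)
  obtain ⟨n, hn⟩ := hint _ (R.subset hz)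
  simp only [hn, hF, mul_div_cancel_right₀ _ hpi, Complex.intCast_re, Int.cast_inj] at hconst
  rw [← hconst, ← hn, hf, indicator_of_mem (P.ψ_mem z).2, P.φ_ψ]

/-! ### Alternating sums of winding numbers around a crossing. -/

namespace Branches

variable {y : E}

/-- The four corners of a crossing in a planar chart. -/
def dirs (B : D.Branches y) (P : D.PlanarChart) : Set ℂ := range fun q : ℤˣ × ℤˣ => B.dir P q.1 q.2

lemma dir_mem_dirs (B : D.Branches y) (P : D.PlanarChart) (s t : ℤˣ) :
    B.dir P s t ∈ B.dirs P := ⟨(s, t), rfl⟩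

lemma finite_dirs (B : D.Branches y) (P : D.PlanarChart) : (B.dirs P).Finite := finite_range _

lemma vel₁_ne_zero (B : D.Branches y) (P : D.PlanarChart) : B.vel₁ P ≠ 0 :=
  P.deriv_curve_ne_zero _ _

lemma vel₂_ne_zero (B : D.Branches y) (P : D.PlanarChart) : B.vel₂ P ≠ 0 :=
  P.deriv_curve_ne_zero _ _

lemma im_vel₂_div_vel₁_ne_zero (B : D.Branches y) (P : D.PlanarChart) :
    (B.vel₂ P / B.vel₁ P).im ≠ 0 := by
  intro h
  have h1 : B.vel₂ P = ((B.vel₂ P / B.vel₁ P).re : ℂ) * B.vel₁ P := by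
    rw [show ((B.vel₂ P / B.vel₁ P).re : ℂ) = B.vel₂ P / B.vel₁ P from
      Complex.ext (by simp) (by simp [h]), div_mul_cancel₀ _ (B.vel₁_ne_zero P)]
  have h2 := LinearIndependent.pair_iff.1 (B.indep_vel P) (-(B.vel₂ P / B.vel₁ P).re) 1 (by
    rw [one_smul, Complex.real_smul, Complex.ofReal_neg, neg_mul, ← h1, neg_add_cancel])
  exact one_ne_zero h2.2

lemma im_vel₁_div_vel₂_mul_neg (B : D.Branches y) (P : D.PlanarChart) :
    (B.vel₂ P / B.vel₁ P).im * (B.vel₁ P / B.vel₂ P).im < 0 := by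
  have := im_inv_mul_im_neg (B.im_vel₂_div_vel₁_ne_zero P)
  rwa [inv_div] at this

lemma im_dir_div_vel₁ (B : D.Branches y) (P : D.PlanarChart) (s t : ℤˣ) :
    (B.dir P s t / B.vel₁ P).im = ((t : ℤ) : ℝ) * (B.vel₂ P / B.vel₁ P).im := by
  rw [dir, Complex.real_smul, Complex.real_smul, add_div, mul_div_assoc, mul_div_assoc,
    div_self (B.vel₁_ne_zero P), Complex.add_im, Complex.im_ofReal_mul, Complex.im_ofReal_mul]
  simp

lemma im_dir_div_vel₂ (B : D.Branches y) (P : D.PlanarChart) (s t : ℤˣ) :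
    (B.dir P s t / B.vel₂ P).im = ((s : ℤ) : ℝ) * (B.vel₁ P / B.vel₂ P).im := by
  rw [dir, Complex.real_smul, Complex.real_smul, add_div, mul_div_assoc, mul_div_assoc,
    div_self (B.vel₂_ne_zero P), Complex.add_im, Complex.im_ofReal_mul, Complex.im_ofReal_mul]
  simp

lemma cast_unit_ne_zero (s : ℤˣ) : ((s : ℤ) : ℝ) ≠ 0 := by
  exact_mod_cast s.ne_zero

lemma im_div_vel₁_ne_zero (B : D.Branches y) (P : D.PlanarChart) {w : ℂ} (hw : w ∈ B.dirs P) :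
    (w / B.vel₁ P).im ≠ 0 := by
  obtain ⟨⟨s, t⟩, rfl⟩ := hw
  rw [im_dir_div_vel₁]
  exact mul_ne_zero (cast_unit_ne_zero t) (B.im_vel₂_div_vel₁_ne_zero P)

lemma im_div_vel₂_ne_zero (B : D.Branches y) (P : D.PlanarChart) {w : ℂ} (hw : w ∈ B.dirs P) :
    (w / B.vel₂ P).im ≠ 0 := by
  obtain ⟨⟨s, t⟩, rfl⟩ := hw
  rw [im_dir_div_vel₂]
  exact mul_ne_zero (cast_unit_ne_zero s)
    fun h => by simpa [h] using B.im_vel₁_div_vel₂_mul_neg P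

lemma deriv_curve_add_int (P : D.PlanarChart) (i : Fin D.l) (t : ℝ) (m : ℤ) :
    deriv (P.curve i) (t + m) = deriv (P.curve i) t := by
  rw [← deriv_comp_add_const]
  congr 1
  ext τ
  simpa using (P.periodic_curve i).int_mul m τ

lemma deriv_curve_of_hit (B : D.Branches y) (P : D.PlanarChart) {k : Fin D.l} {τ : ℝ}
    (h : D.curve k τ = y) :
    deriv (P.curve k) τ = B.vel₁ P ∨ deriv (P.curve k) τ = B.vel₂ P := by
  obtain ⟨m, ⟨rfl, rfl⟩ | ⟨rfl, rfl⟩⟩ := B.all k τ h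
  · exact Or.inl (deriv_curve_add_int P _ _ _)
  · exact Or.inr (deriv_curve_add_int P _ _ _)

lemma im_div_deriv_ne_zero (B : D.Branches y) (P : D.PlanarChart) {k : Fin D.l} {τ : ℝ}
    (h : D.curve k τ = y) {w : ℂ} (hw : w ∈ B.dirs P) : (w / deriv (P.curve k) τ).im ≠ 0 := by
  rcases B.deriv_curve_of_hit P h with e | e <;> rw [e]
  · exact B.im_div_vel₁_ne_zero P hw
  · exact B.im_div_vel₂_ne_zero P hw

/-- `R s t` is the region into which the corner `(s, t)` of the crossing points. -/
structure IsCornerRegion (B : D.Branches y) (P : D.PlanarChart) (R : ℤˣ → ℤˣ → D.Region) :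
    Prop where
  eventually_mem : ∀ s t (d : ℝ → ℂ), d 0 = P.φ y →
    HasDerivWithinAt d (B.dir P s t) (Ioi 0) 0 → ∀ᶠ r in 𝓝[>] (0 : ℝ), P.ψ (d r) ∈ (R s t).1
  eq_of_mem_closure : ∀ R' : D.Region, y ∈ closure R'.1 → ∃ s t, R' = R s t

namespace IsCornerRegion

variable {B : D.Branches y} {P : D.PlanarChart} {R : ℤˣ → ℤˣ → D.Region}

lemma hasDerivAt_ray (z w : ℂ) : HasDerivAt (fun r : ℝ => z + r * w) w 0 := by
  simpa using ((Complex.ofRealCLM.hasDerivAt (x := (0 : ℝ))).mul_const w).const_add z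

lemma eventually_ray (h : B.IsCornerRegion P R) (s t : ℤˣ) :
    ∀ᶠ r : ℝ in 𝓝[>] 0, P.ψ (P.φ y + r * B.dir P s t) ∈ (R s t).1 :=
  h.eventually_mem s t _ (by simp) (hasDerivAt_ray _ _).hasDerivWithinAt

lemma eventually_ne (h : B.IsCornerRegion P R) (i : Fin D.l) :
    ∀ w ∈ B.dirs P, ∀ᶠ r : ℝ in 𝓝[>] 0, ∀ τ, P.curve i τ ≠ P.φ y + r * w := by
  rintro _ ⟨⟨s, t⟩, rfl⟩
  filter_upwards [h.eventually_ray s t] with r hr τ e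
  exact ((R s t).subset hr).2 (P.ψ_mem_image_iff.2 ⟨i, τ, e⟩)

/-- Differences of winding numbers at the corners are given by the asymptotics of the integral. -/
lemma sum_winding (h : B.IsCornerRegion P R) {i : Fin D.l} {a b : ℝ} {g : ℂ → ℂ}
    (hg : LogAsymptotic (P.curve i) a b (P.φ y) (B.dirs P) g) {F : D.Region → ℤ}
    (hF : ∀ (R : D.Region) (z : ℂ), P.ψ z ∈ R.1 →
      logInt (P.curve i) a b z = F R * (2 * Real.pi * Complex.I))
    (k : ℤˣ → ℤˣ → ℤ) (hk : ∑ s, ∑ t, k s t = 0) :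
    ((∑ s, ∑ t, k s t * F (R s t) : ℤ) : ℂ) * (2 * Real.pi * Complex.I)
      = ∑ s, ∑ t, (k s t : ℂ) * g (B.dir P s t) := by
  obtain ⟨L, hL⟩ := hg
  -- For small `r` this expression is constant, because each ray stays in its corner region and `hk`
  -- removes `L r`; so the constant equals the limit.
  have h1 : Tendsto (fun r : ℝ => ∑ s, ∑ t, (k s t : ℂ) *
      (logInt (P.curve i) a b (P.φ y + r * B.dir P s t) - L r)) (𝓝[>] 0)
      (𝓝 (∑ s, ∑ t, (k s t : ℂ) * g (B.dir P s t))) :=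
    tendsto_finsetSum _ fun s _ => tendsto_finsetSum _ fun t _ =>
      (hL _ (B.dir_mem_dirs P s t)).const_mul _
  have h2 : ∀ᶠ r : ℝ in 𝓝[>] 0, ∑ s, ∑ t, (k s t : ℂ) *
      (logInt (P.curve i) a b (P.φ y + r * B.dir P s t) - L r)
      = ((∑ s, ∑ t, k s t * F (R s t) : ℤ) : ℂ) * (2 * Real.pi * Complex.I) := by
    have hall : ∀ᶠ r : ℝ in 𝓝[>] 0, ∀ s t, P.ψ (P.φ y + r * B.dir P s t) ∈ (R s t).1 :=
      eventually_all.2 fun s => eventually_all.2 fun t => h.eventually_ray s t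
    filter_upwards [hall] with r hr
    have hk' : ∑ s, ∑ t, (k s t : ℂ) = 0 := by exact_mod_cast hk
    have : ∀ s t, logInt (P.curve i) a b (P.φ y + r * B.dir P s t)
        = F (R s t) * (2 * Real.pi * Complex.I) := fun s t => hF _ _ (hr s t)
    simp only [this, mul_sub, Finset.sum_sub_distrib, ← Finset.sum_mul]
    rw [hk', zero_mul, sub_zero]
    push_cast
    simp only [Finset.sum_mul, mul_assoc]
  exact tendsto_nhds_unique (tendsto_const_nhds.congr' (h2.mono fun r hr => hr.symm)) h1

lemma dir_neg (B : D.Branches y) (P : D.PlanarChart) (s t : ℤˣ) :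
    B.dir P (-s) (-t) = -B.dir P s t := by
  simp only [dir, Units.val_neg, Int.cast_neg, neg_smul]
  ring

/-- At a crossing away from the base point of a loop, the alternating sum of the winding numbers
vanishes. -/
lemma alternating_sum_eq_zero (h : B.IsCornerRegion P R) {i : Fin D.l} {a b : ℝ} (hab : a ≤ b)
    (ha : D.curve i a ≠ y) (hb : D.curve i b ≠ y)
    (hfin : {τ ∈ Icc a b | D.curve i τ = y}.Finite) {F : D.Region → ℤ}
    (hF : ∀ (R : D.Region) (z : ℂ), P.ψ z ∈ R.1 →
      logInt (P.curve i) a b z = F R * (2 * Real.pi * Complex.I)) :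
    ∑ s, ∑ t, ((s * t : ℤˣ) : ℤ) * F (R s t) = 0 := by
  have hmem : ∀ τ, τ ∈ hfin.toFinset ↔ τ ∈ Icc a b ∧ D.curve i τ = y := fun τ => by simp
  have hg := logAsymptotic_of_interior (P.contDiff_curve i) (P.deriv_curve_ne_zero i)
    (B.finite_dirs P) (h.eventually_ne i) hfin.toFinset
    (fun τ hτ => (P.curve_eq_φ_iff B.mem_image).2 ((hmem τ).1 hτ).2)
    (fun τ hτ w hw => B.im_div_deriv_ne_zero P ((hmem τ).1 hτ).2 hw) b hab
    (fun τ hτ => by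
      obtain ⟨h1, h2⟩ := (hmem τ).1 hτ
      exact ⟨lt_of_le_of_ne h1.1 fun e => ha (e ▸ h2), lt_of_le_of_ne h1.2 fun e => hb (e ▸ h2)⟩)
    (fun τ hτ e => (hmem τ).2 ⟨hτ, (P.curve_eq_φ_iff B.mem_image).1 e⟩)
  have key := h.sum_winding hg hF (fun s t => ((s * t : ℤˣ) : ℤ)) (by rw [sum_units]; simp)
  -- The coefficient `s * t` is the same at opposite corners, while `branchJump` changes sign.
  have hz : ∑ s, ∑ t, (((s * t : ℤˣ) : ℤ) : ℂ) *
      ∑ τ ∈ hfin.toFinset, branchJump (deriv (P.curve i) τ) (B.dir P s t) = 0 := by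
    rw [sum_units]
    have e1 : B.dir P (-1) (-1) = -B.dir P 1 1 := dir_neg B P 1 1
    have e2 : B.dir P (-1) 1 = -B.dir P 1 (-1) := by simpa using dir_neg B P 1 (-1)
    rw [e1, e2]
    simp only [branchJump_neg, Finset.sum_neg_distrib]
    simp
  rw [hz] at key
  exact_mod_cast (mul_eq_zero.1 key).resolve_right Complex.two_pi_I_ne_zero

/-- At the base point of a loop, the alternating sum of the winding numbers is `±1`. -/
lemma alternating_sum_base (h : B.IsCornerRegion P R) (hi : B.i₁ = B.i₂) (hlt : B.t₁ < B.t₂)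
    (hall : ∀ τ ∈ Ioo B.t₁ B.t₂, D.curve B.i₁ τ ≠ y) {F : D.Region → ℤ}
    (hF : ∀ (R : D.Region) (z : ℂ), P.ψ z ∈ R.1 →
      logInt (P.curve B.i₁) B.t₁ B.t₂ z = F R * (2 * Real.pi * Complex.I)) :
    ∃ σ : ℤˣ, ∑ s, ∑ t, ((s * t : ℤˣ) : ℤ) * F (R s t) = σ := by
  have hv2 : deriv (P.curve B.i₁) B.t₂ = B.vel₂ P := by rw [vel₂, hi]
  have hg := logAsymptotic_of_endpoints (P.contDiff_curve B.i₁) hlt (P.deriv_curve_ne_zero B.i₁)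
    (B.finite_dirs P) (h.eventually_ne B.i₁) (B.curve_hit₁ P) (by rw [hi]; exact B.curve_hit₂ P)
    (fun τ hτ e => hall τ hτ ((P.curve_eq_φ_iff B.mem_image).1 e))
    (fun w hw => B.im_div_vel₁_ne_zero P hw)
    (fun w hw => by rw [hv2]; exact B.im_div_vel₂_ne_zero P hw)
  have key := h.sum_winding hg hF (fun s t => ((s * t : ℤˣ) : ℤ)) (by rw [sum_units]; simp)
  have hba : (B.vel₁ P / B.vel₂ P).im ≠ 0 := fun e => by
    simpa [e] using B.im_vel₁_div_vel₂_mul_neg P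
  -- The loop leaves with the velocity of the first branch and returns with that of the second.
  have halt := alternating_sum_loop (B.vel₁_ne_zero P) (B.vel₂_ne_zero P) hba
    (g := fun w => Complex.log (w / deriv (P.curve B.i₁) B.t₂)
      - Complex.log (-w / deriv (P.curve B.i₁) B.t₁)) (fun w => by rw [hv2]; rfl)
  have e1 : B.dir P 1 1 = B.vel₁ P + B.vel₂ P := by simp [dir]
  have e2 : B.dir P 1 (-1) = B.vel₁ P - B.vel₂ P := by simp [dir, sub_eq_add_neg]
  have e3 : B.dir P (-1) 1 = -B.vel₁ P + B.vel₂ P := by simp [dir]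
  have e4 : B.dir P (-1) (-1) = -B.vel₁ P - B.vel₂ P := by simp [dir, sub_eq_add_neg]
  have key2 : ((∑ s, ∑ t, ((s * t : ℤˣ) : ℤ) * F (R s t) : ℤ) : ℂ) * (2 * Real.pi * Complex.I)
      = SignType.sign (B.vel₂ P / B.vel₁ P).im * (2 * Real.pi * Complex.I) := by
    rw [key, ← halt, sum_units, e1, e2, e3, e4]
    push_cast
    ring
  have key3 := mul_right_cancel₀ Complex.two_pi_I_ne_zero key2
  rcases lt_or_gt_of_ne (B.im_vel₂_div_vel₁_ne_zero P) with hs | hs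
  · refine ⟨-1, ?_⟩
    rw [sign_neg hs, SignType.coe_neg_one] at key3
    exact_mod_cast key3
  · refine ⟨1, ?_⟩
    rw [sign_pos hs, SignType.coe_one] at key3
    exact_mod_cast key3

end IsCornerRegion

end Branches

/-! ### Periodicity and finiteness of the set of crossings. -/

lemma curve_add_int (D : LinkProjection S) (i : Fin D.l) (t : ℝ) (m : ℤ) :
    D.curve i (t + m) = D.curve i t := by
  simpa using (D.periodic i).int_mul m t

lemma curve_fract (D : LinkProjection S) (i : Fin D.l) (t : ℝ) :
    D.curve i (Int.fract t) = D.curve i t := by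
  rw [← D.curve_add_int i (Int.fract t) ⌊t⌋, Int.fract_add_floor]

lemma deriv_curve_add_int (D : LinkProjection S) (i : Fin D.l) (t : ℝ) (m : ℤ) :
    deriv (D.curve i) (t + m) = deriv (D.curve i) t := by
  rw [← deriv_comp_add_const]
  congr 1
  ext τ
  exact D.curve_add_int i τ m

lemma deriv_curve_fract (D : LinkProjection S) (i : Fin D.l) (t : ℝ) :
    deriv (D.curve i) (Int.fract t) = deriv (D.curve i) t := by
  rw [← D.deriv_curve_add_int i (Int.fract t) ⌊t⌋, Int.fract_add_floor]

lemma eq_or_eq_of_hits {p : E} {q₁ q₂ q : Fin D.l × ℝ} (hne : q₁ ≠ q₂)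
    (h₁ : q₁.2 ∈ Ico (0 : ℝ) 1 ∧ D.curve q₁.1 q₁.2 = p)
    (h₂ : q₂.2 ∈ Ico (0 : ℝ) 1 ∧ D.curve q₂.1 q₂.2 = p)
    (h : q.2 ∈ Ico (0 : ℝ) 1 ∧ D.curve q.1 q.2 = p) : q = q₁ ∨ q = q₂ := by
  by_contra! hq
  have hsub : ({q, q₁, q₂} : Set (Fin D.l × ℝ)) ⊆
      {q : Fin D.l × ℝ | q.2 ∈ Ico (0 : ℝ) 1 ∧ D.curve q.1 q.2 = p} := by
    rintro r (rfl | rfl | rfl)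
    exacts [h, h₁, h₂]
  have h3 := (encard_le_encard hsub).trans (D.double p)
  rw [encard_insert_of_notMem (by simp [hq.1, hq.2]), encard_pair hne] at h3
  exact absurd h3 (by norm_num)

/-- The branches at a crossing, given by two different parameters. -/
def branchesOf {p : E} {i j : Fin D.l} {s t : ℝ} (hs : s ∈ Ico (0 : ℝ) 1) (ht : t ∈ Ico (0 : ℝ) 1)
    (hne : (i, s) ≠ (j, t)) (h₁ : D.curve i s = p) (h₂ : D.curve j t = p) : D.Branches p where
  i₁ := i
  t₁ := s
  i₂ := j
  t₂ := t
  hit₁ := h₁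
  hit₂ := h₂
  indep := D.transverse i j s t hs ht hne (h₁.trans h₂.symm)
  all k τ h := by
    refine ⟨⌊τ⌋, ?_⟩
    have hτ : Int.fract τ ∈ Ico (0 : ℝ) 1 := ⟨Int.fract_nonneg _, Int.fract_lt_one _⟩
    have e : ∀ u, Int.fract τ = u → τ = u + ⌊τ⌋ := by
      rintro _ rfl
      exact (Int.fract_add_floor τ).symm
    rcases eq_or_eq_of_hits hne ⟨hs, h₁⟩ ⟨ht, h₂⟩ (q := (k, Int.fract τ))
      ⟨hτ, (D.curve_fract k τ).trans h⟩ with h | h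
    · exact Or.inl ⟨congrArg Prod.fst h, e _ (congrArg Prod.snd h)⟩
    · exact Or.inr ⟨congrArg Prod.fst h, e _ (congrArg Prod.snd h)⟩

lemma finite_hits (D : LinkProjection S) (p : E) (i : Fin D.l) {K : Set ℝ}
    (hK : K ⊆ Ico (0 : ℝ) 1) : {τ ∈ K | D.curve i τ = p}.Finite := by
  have h : {q : Fin D.l × ℝ | q.2 ∈ Ico (0 : ℝ) 1 ∧ D.curve q.1 q.2 = p}.Finite :=
    finite_of_encard_le_coe (k := 2) (D.double p)
  exact (h.image Prod.snd).subset fun τ hτ => ⟨(i, τ), ⟨hK hτ.1, hτ.2⟩, rfl⟩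

/-- Three cases for a pair of times. If the points differ, nearby pairs give no crossing. If the
times represent the same parameter, local injectivity of an immersion excludes crossings nearby. If
the branches are distinct, transversality makes the difference of the two curves locally injective,
so the pair is isolated. -/
lemma exists_nhds_finite_crossings (D : LinkProjection S) (i j : Fin D.l) (x : ℝ × ℝ) :
    ∃ N ∈ 𝓝 x, {p | ∃ q ∈ N, q.1 ∈ Ico (0 : ℝ) 1 ∧ q.2 ∈ Ico (0 : ℝ) 1 ∧ (i, q.1) ≠ (j, q.2) ∧
      D.curve i q.1 = p ∧ D.curve j q.2 = p}.Finite := by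
  have hc1 : ContinuousAt (fun q : ℝ × ℝ => D.curve i q.1) x :=
    ((D.contDiff_curve i).continuous.comp continuous_fst).continuousAt
  have hc2 : ContinuousAt (fun q : ℝ × ℝ => D.curve j q.2) x :=
    ((D.contDiff_curve j).continuous.comp continuous_snd).continuousAt
  by_cases hx : D.curve i x.1 = D.curve j x.2
  · by_cases hsame : (i, Int.fract x.1) = (j, Int.fract x.2)
    · obtain ⟨rfl, hfr⟩ := Prod.ext_iff.1 hsame
      obtain ⟨m, hm⟩ := Int.fract_eq_fract.1 hfr
      have hst : HasStrictFDerivAt (D.curve i)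
          (ContinuousLinearMap.toSpanSingleton ℝ (deriv (D.curve i) x.1)) x.1 :=
        ((D.contDiff_curve i).contDiffAt.hasStrictDerivAt one_ne_zero).hasStrictFDerivAt
      have hinj : Function.Injective
          (ContinuousLinearMap.toSpanSingleton ℝ (deriv (D.curve i) x.1)) := by
        refine (injective_iff_map_eq_zero _).2 fun r hr => ?_
        rw [ContinuousLinearMap.toSpanSingleton_apply] at hr
        exact (smul_eq_zero.1 hr).resolve_right (D.immersed i x.1)
      have hct : ContinuousAt (fun q : ℝ × ℝ => (q.1, q.2 + m)) x := by fun_prop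
      have hev := hct.tendsto.eventually (p := fun p : ℝ × ℝ =>
        D.curve i p.1 = D.curve i p.2 → p.1 = p.2) (by
          rw [← hm, add_sub_cancel]; exact hst.eventually_injective hinj)
      refine ⟨_, hev, ?_⟩
      convert finite_empty
      rw [eq_empty_iff_forall_notMem]
      rintro p ⟨q, hq, h1, h2, hne, e1, e2⟩
      have hq' : q.1 = q.2 + m := hq (by rw [e1]; simp only; rw [D.curve_add_int, e2])
      have hf : Int.fract q.1 = Int.fract q.2 := by rw [hq', Int.fract_add_intCast]
      rw [Int.fract_eq_self.2 h1, Int.fract_eq_self.2 h2] at hf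
      exact hne (by rw [hf])
    · have hind := D.transverse i j (Int.fract x.1) (Int.fract x.2)
        ⟨Int.fract_nonneg _, Int.fract_lt_one _⟩ ⟨Int.fract_nonneg _, Int.fract_lt_one _⟩ hsame
        (by rw [D.curve_fract, D.curve_fract, hx])
      rw [D.deriv_curve_fract, D.deriv_curve_fract] at hind
      have d1 : HasStrictFDerivAt (D.curve i)
          (ContinuousLinearMap.toSpanSingleton ℝ (deriv (D.curve i) x.1)) x.1 :=
        ((D.contDiff_curve i).contDiffAt.hasStrictDerivAt one_ne_zero).hasStrictFDerivAt
      have d2 : HasStrictFDerivAt (D.curve j)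
          (ContinuousLinearMap.toSpanSingleton ℝ (deriv (D.curve j) x.2)) x.2 :=
        ((D.contDiff_curve j).contDiffAt.hasStrictDerivAt one_ne_zero).hasStrictFDerivAt
      have d3 := (d1.comp x hasStrictFDerivAt_fst).sub (d2.comp x hasStrictFDerivAt_snd)
      have hev := d3.eventually_injective (by
        refine (injective_iff_map_eq_zero _).2 fun r hr => ?_
        have := LinearIndependent.pair_iff.1 hind r.1 (-r.2) (by
          simpa [sub_eq_add_neg] using hr)
        exact Prod.ext this.1 (neg_eq_zero.1 this.2))
      have hct : ContinuousAt (fun q : ℝ × ℝ => (q, x)) x := by fun_prop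
      refine ⟨_, hct.tendsto.eventually hev, (finite_singleton (D.curve i x.1)).subset ?_⟩
      rintro p ⟨q, hq, h1, h2, hne, e1, e2⟩
      have hq' : q = x := hq (by
        simp only [Pi.sub_apply]
        rw [hx, sub_self, e1, e2, sub_self])
      rw [mem_singleton_iff, ← e1, hq']
  · refine ⟨_, (hc1.sub hc2).eventually_ne (sub_ne_zero.2 hx), ?_⟩
    convert finite_empty
    rw [eq_empty_iff_forall_notMem]
    rintro p ⟨q, hq, -, -, -, h1, h2⟩
    exact hq (sub_eq_zero.2 (h1.trans h2.symm))

/-- A link projection has finitely many crossings. -/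
lemma finite_crossing (D : LinkProjection S) : Finite D.Crossing := by
  have key : ∀ i j : Fin D.l, {p | ∃ q ∈ Icc (0 : ℝ) 1 ×ˢ Icc (0 : ℝ) 1, q.1 ∈ Ico (0 : ℝ) 1 ∧
      q.2 ∈ Ico (0 : ℝ) 1 ∧ (i, q.1) ≠ (j, q.2) ∧ D.curve i q.1 = p ∧ D.curve j q.2 = p}.Finite := by
    intro i j
    refine IsCompact.induction_on (isCompact_Icc.prod isCompact_Icc)
      (p := fun K => {p | ∃ q ∈ K, q.1 ∈ Ico (0 : ℝ) 1 ∧ q.2 ∈ Ico (0 : ℝ) 1 ∧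
        (i, q.1) ≠ (j, q.2) ∧ D.curve i q.1 = p ∧ D.curve j q.2 = p}.Finite) ?_ ?_ ?_ ?_
    · simp
    · intro K K' hKK' h
      exact h.subset fun p ⟨q, hq, h⟩ => ⟨q, hKK' hq, h⟩
    · intro K K' h h'
      refine (h.union h').subset ?_
      rintro p ⟨q, hq | hq, h⟩
      exacts [Or.inl ⟨q, hq, h⟩, Or.inr ⟨q, hq, h⟩]
    · intro x _
      obtain ⟨N, hN, h⟩ := D.exists_nhds_finite_crossings i j x
      exact ⟨N, mem_nhdsWithin_of_mem_nhds hN, h⟩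
  have hfin : {p : E | D.IsCrossing p}.Finite := by
    refine (finite_iUnion fun i => finite_iUnion fun j => key i j).subset ?_
    rintro p ⟨i, j, s, t, hs, ht, h⟩
    simp only [mem_iUnion]
    exact ⟨i, j, (s, t), ⟨Ico_subset_Icc_self hs, Ico_subset_Icc_self ht⟩, hs, ht, h⟩
  exact hfin.to_subtype

/-! ### The checkerboard coloring. -/

namespace Branches

variable {y : E}

/-- Starting a period at such a time puts all passages of `y` in its interior, as
`logAsymptotic_of_interior` requires. -/
lemma exists_time_off (B : D.Branches y) : ∃ τ : ℝ, ∀ j, D.curve j τ ≠ y := by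
  have hc : (range (fun m : ℤ => B.t₁ + m) ∪ range (fun m : ℤ => B.t₂ + m)).Countable :=
    (countable_range _).union (countable_range _)
  obtain ⟨τ, hτ⟩ := (hc.dense_compl ℝ).nonempty
  refine ⟨τ, fun j h => hτ ?_⟩
  obtain ⟨m, ⟨-, h⟩ | ⟨-, h⟩⟩ := B.all j τ h
  · exact Or.inl ⟨m, h.symm⟩
  · exact Or.inr ⟨m, h.symm⟩

lemma exists_shift_mem_Ioo {i : Fin D.l} {t τ : ℝ} (h : D.curve i t = y) (hτ : D.curve i τ ≠ y) :
    ∃ m : ℤ, t + m ∈ Ioo τ (τ + 1) := by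
  refine ⟨-⌊t - τ⌋, ?_, ?_⟩
  · push_cast
    refine lt_of_le_of_ne (by linarith [Int.floor_le (t - τ)]) fun e => hτ ?_
    rw [e, ← h, ← D.curve_add_int i t (-⌊t - τ⌋)]
    push_cast
    rfl
  · push_cast
    linarith [Int.lt_floor_add_one (t - τ)]

lemma eq_of_mem_Icc_of_mem_Ioo {τ u v : ℝ} {m : ℤ} (hu : u ∈ Icc τ (τ + 1))
    (hv : v ∈ Ioo τ (τ + 1)) (h : u = v + m) : u = v := by
  have h1 : (m : ℝ) < 1 := by linarith [hu.2, hv.1]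
  have h2 : (-1 : ℝ) < m := by linarith [hu.1, hv.2]
  have h3 : m < 1 := by exact_mod_cast h1
  have h4 : -1 < m := by exact_mod_cast h2
  have : m = 0 := by omega
  rw [h, this, Int.cast_zero, add_zero]

lemma logInt_period (P : D.PlanarChart) (i : Fin D.l) (τ : ℝ) (z : ℂ) :
    logInt (P.curve i) τ (τ + 1) z = logInt (P.curve i) 0 1 z := by
  have hp : Function.Periodic (fun t => deriv (P.curve i) t / (P.curve i t - z)) 1 := by
    intro t
    have := deriv_curve_add_int P i t 1
    rw [Int.cast_one] at this
    simp only [this, P.periodic_curve i t]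
  have := hp.intervalIntegral_add_eq τ 0
  rwa [zero_add] at this

namespace IsCornerRegion

variable {B : D.Branches y} {P : D.PlanarChart} {R : ℤˣ → ℤˣ → D.Region}

lemma sub_winding (h : B.IsCornerRegion P R) {i : Fin D.l} {a b : ℝ} {g : ℂ → ℂ}
    (hg : LogAsymptotic (P.curve i) a b (P.φ y) (B.dirs P) g) {F : D.Region → ℤ}
    (hF : ∀ (R : D.Region) (z : ℂ), P.ψ z ∈ R.1 →
      logInt (P.curve i) a b z = F R * (2 * Real.pi * Complex.I)) (s t s' t' : ℤˣ) :
    ((F (R s t) - F (R s' t') : ℤ) : ℂ) * (2 * Real.pi * Complex.I)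
      = g (B.dir P s t) - g (B.dir P s' t') := by
  have key := h.sum_winding hg hF (fun u v => (if u = s then if v = t then 1 else 0 else 0)
    - (if u = s' then if v = t' then 1 else 0 else 0)) (by simp [-UnitsInt.univ])
  have e1 : ∀ f : ℤˣ → ℤˣ → ℤ, ∑ u, ∑ v, ((if u = s then if v = t then 1 else 0 else 0)
    - (if u = s' then if v = t' then 1 else 0 else 0)) * f u v = f s t - f s' t' := by
    intro f
    simp [sub_mul, ite_mul, -UnitsInt.univ]
  have e2 : ∀ f : ℤˣ → ℤˣ → ℂ, ∑ u, ∑ v, ((((if u = s then if v = t then 1 else 0 else 0)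
    - (if u = s' then if v = t' then 1 else 0 else 0) : ℤ)) : ℂ) * f u v = f s t - f s' t' := by
    intro f
    simp [sub_mul, ite_mul, -UnitsInt.univ]
  rw [e1 fun u v => F (R u v), e2 fun u v => g (B.dir P u v)] at key
  exact key

lemma sign_unit_mul (t : ℤˣ) (x : ℝ) :
    (SignType.sign (((t : ℤ) : ℝ) * x) : ℂ) = (t : ℤ) * SignType.sign x := by
  rcases Int.units_eq_one_or t with rfl | rfl <;> simp [Left.sign_neg]

/-- The total winding numbers of the link projection at the four corners of a crossing. -/
lemma total_winding (h : B.IsCornerRegion P R) {N : Fin D.l → D.Region → ℤ}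
    (hN : ∀ (j : Fin D.l) (R : D.Region) (z : ℂ), P.ψ z ∈ R.1 →
      logInt (P.curve j) 0 1 z = N j R * (2 * Real.pi * Complex.I)) :
    ∃ σ : ℤˣ, ∀ s t : ℤˣ,
      2 * (∑ j, N j (R s t) - ∑ j, N j (R 1 1)) = (σ : ℤ) * ((t : ℤ) - (s : ℤ)) := by
  obtain ⟨τ, hτ⟩ := B.exists_time_off
  obtain ⟨m₁, hm₁⟩ := exists_shift_mem_Ioo B.hit₁ (hτ B.i₁)
  obtain ⟨m₂, hm₂⟩ := exists_shift_mem_Ioo B.hit₂ (hτ B.i₂)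
  set u₁ := B.t₁ + m₁ with hu₁
  set u₂ := B.t₂ + m₂ with hu₂
  have v₁ : deriv (P.curve B.i₁) u₁ = B.vel₁ P := deriv_curve_add_int P _ _ _
  have v₂ : deriv (P.curve B.i₂) u₂ = B.vel₂ P := deriv_curve_add_int P _ _ _
  have c₁ : D.curve B.i₁ u₁ = y := (D.curve_add_int _ _ _).trans B.hit₁
  have c₂ : D.curve B.i₂ u₂ = y := (D.curve_add_int _ _ _).trans B.hit₂
  have hne : B.i₁ = B.i₂ → u₁ ≠ u₂ := by
    intro hi hu
    have h1 := B.im_vel₂_div_vel₁_ne_zero P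
    rw [← v₁, ← v₂, hi, hu, div_self (P.deriv_curve_ne_zero _ _), Complex.one_im] at h1
    exact h1 rfl
  -- The passages of component `j` through the crossing within the period; both branches may belong
  -- to the same component.
  set T : Fin D.l → Finset ℝ := fun j =>
    (if B.i₁ = j then {u₁} else ∅) ∪ (if B.i₂ = j then {u₂} else ∅) with hT
  have hTmem : ∀ j v, v ∈ T j ↔ (B.i₁ = j ∧ v = u₁) ∨ (B.i₂ = j ∧ v = u₂) := by
    intro j v
    simp only [hT, Finset.mem_union]
    split_ifs <;> simp_all
  have hThit : ∀ j, ∀ v ∈ T j, D.curve j v = y := by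
    intro j v hv
    rcases (hTmem j v).1 hv with ⟨rfl, rfl⟩ | ⟨rfl, rfl⟩
    exacts [c₁, c₂]
  have hTsum : ∀ (j : Fin D.l) (w : ℂ), ∑ v ∈ T j, branchJump (deriv (P.curve j) v) w
      = (if B.i₁ = j then branchJump (B.vel₁ P) w else 0)
        + (if B.i₂ = j then branchJump (B.vel₂ P) w else 0) := by
    intro j w
    simp only [hT]
    rw [Finset.sum_union]
    · congr 1
      · split_ifs with hj
        · subst hj; rw [Finset.sum_singleton, v₁]
        · simp
      · split_ifs with hj
        · subst hj; rw [Finset.sum_singleton, v₂]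
        · simp
    · split_ifs with h1 h2
      · exact Finset.disjoint_singleton.2 (hne (h1.trans h2.symm))
      all_goals simp
  have hasym : ∀ j, LogAsymptotic (P.curve j) τ (τ + 1) (P.φ y) (B.dirs P)
      fun w => ∑ v ∈ T j, branchJump (deriv (P.curve j) v) w := by
    intro j
    refine logAsymptotic_of_interior (P.contDiff_curve j) (P.deriv_curve_ne_zero j)
      (B.finite_dirs P) (h.eventually_ne j) (T j)
      (fun v hv => (P.curve_eq_φ_iff B.mem_image).2 (hThit j v hv))
      (fun v hv w hw => B.im_div_deriv_ne_zero P (hThit j v hv) hw) _ (by linarith) ?_ ?_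
    · intro v hv
      rcases (hTmem j v).1 hv with ⟨rfl, rfl⟩ | ⟨rfl, rfl⟩
      exacts [hm₁, hm₂]
    · intro v hv e
      obtain ⟨m, ⟨rfl, hm⟩ | ⟨rfl, hm⟩⟩ := B.all j v ((P.curve_eq_φ_iff B.mem_image).1 e)
      · refine (hTmem _ v).2 (Or.inl ⟨rfl, ?_⟩)
        exact eq_of_mem_Icc_of_mem_Ioo (m := m - m₁) hv hm₁ (by rw [hm, hu₁]; push_cast; ring)
      · refine (hTmem _ v).2 (Or.inr ⟨rfl, ?_⟩)
        exact eq_of_mem_Icc_of_mem_Ioo (m := m - m₂) hv hm₂ (by rw [hm, hu₂]; push_cast; ring)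
  have hdiff : ∀ s t : ℤˣ,
      ((∑ j, N j (R s t) - ∑ j, N j (R 1 1) : ℤ) : ℂ) * (2 * Real.pi * Complex.I)
      = (branchJump (B.vel₁ P) (B.dir P s t) - branchJump (B.vel₁ P) (B.dir P 1 1))
        + (branchJump (B.vel₂ P) (B.dir P s t) - branchJump (B.vel₂ P) (B.dir P 1 1)) := by
    intro s t
    have hj : ∀ j, ((N j (R s t) - N j (R 1 1) : ℤ) : ℂ) * (2 * Real.pi * Complex.I)
        = ((if B.i₁ = j then branchJump (B.vel₁ P) (B.dir P s t) else 0)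
          + (if B.i₂ = j then branchJump (B.vel₂ P) (B.dir P s t) else 0))
          - ((if B.i₁ = j then branchJump (B.vel₁ P) (B.dir P 1 1) else 0)
          + (if B.i₂ = j then branchJump (B.vel₂ P) (B.dir P 1 1) else 0)) := by
      intro j
      rw [h.sub_winding (hasym j) (F := N j)
        (fun R z hz => (logInt_period P j τ z).trans (hN j R z hz)) s t 1 1, hTsum, hTsum]
    rw [← Finset.sum_sub_distrib, Int.cast_sum, Finset.sum_mul, Finset.sum_congr rfl fun j _ => hj j,
      Finset.sum_sub_distrib, Finset.sum_add_distrib, Finset.sum_add_distrib]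
    simp only [Finset.sum_ite_eq, Finset.mem_univ, if_true]
    ring
  have hJ₁ : ∀ s t : ℤˣ, branchJump (B.vel₁ P) (B.dir P s t)
      = (t : ℤ) * SignType.sign (B.vel₂ P / B.vel₁ P).im * (Real.pi * Complex.I) := by
    intro s t
    rw [branchJump_eq (B.im_div_vel₁_ne_zero P (B.dir_mem_dirs P s t)), im_dir_div_vel₁,
      ← sign_unit_mul]
  have hJ₂ : ∀ s t : ℤˣ, branchJump (B.vel₂ P) (B.dir P s t)
      = (s : ℤ) * SignType.sign (B.vel₁ P / B.vel₂ P).im * (Real.pi * Complex.I) := by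
    intro s t
    rw [branchJump_eq (B.im_div_vel₂_ne_zero P (B.dir_mem_dirs P s t)), im_dir_div_vel₂,
      ← sign_unit_mul]
  have hpi : (Real.pi * Complex.I : ℂ) ≠ 0 := by simp [Real.pi_ne_zero]
  -- A number and its inverse have imaginary parts of opposite signs, whence the difference `t - s`.
  -- The jumps are multiples of `π * I`, half of the period `2 * π * I`, whence the factor `2` in
  -- the claim.
  obtain ⟨σ, hσ₁, hσ₂⟩ : ∃ σ : ℤˣ,
      (SignType.sign (B.vel₂ P / B.vel₁ P).im : ℂ) = (σ : ℤ) ∧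
      (SignType.sign (B.vel₁ P / B.vel₂ P).im : ℂ) = -(σ : ℤ) := by
    rcases mul_neg_iff.1 (B.im_vel₁_div_vel₂_mul_neg P) with ⟨h1, h2⟩ | ⟨h1, h2⟩
    · exact ⟨1, by simp [sign_pos h1], by simp [sign_neg h2]⟩
    · exact ⟨-1, by simp [sign_neg h1], by simp [sign_pos h2]⟩
  refine ⟨σ, fun s t => ?_⟩
  have h1 := hdiff s t
  rw [hJ₁, hJ₁, hJ₂, hJ₂, hσ₁, hσ₂] at h1
  have h2 : ((2 * (∑ j, N j (R s t) - ∑ j, N j (R 1 1)) : ℤ) : ℂ) * (Real.pi * Complex.I)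
      = (((σ : ℤ) * ((t : ℤ) - (s : ℤ)) : ℤ) : ℂ) * (Real.pi * Complex.I) := by
    rw [Int.cast_mul 2]
    linear_combination (norm := (push_cast; ring)) h1
  exact_mod_cast mul_right_cancel₀ hpi h2

/-- The checkerboard coloring alternates around a crossing. -/
lemma negOnePow_total_winding (h : B.IsCornerRegion P R) {N : Fin D.l → D.Region → ℤ}
    (hN : ∀ (j : Fin D.l) (R : D.Region) (z : ℂ), P.ψ z ∈ R.1 →
      logInt (P.curve j) 0 1 z = N j R * (2 * Real.pi * Complex.I)) (s t : ℤˣ) :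
    (∑ j, N j (R s t)).negOnePow = (∑ j, N j (R 1 1)).negOnePow * (s * t) := by
  obtain ⟨σ, hσ⟩ := h.total_winding hN
  have key := hσ s t
  generalize ∑ j, N j (R s t) = n at key ⊢
  generalize ∑ j, N j (R 1 1) = n' at key ⊢
  have hone : ∀ k : ℤ, (k - 1).negOnePow = -k.negOnePow := fun k => by
    rw [← neg_eq_iff_eq_neg, ← Int.negOnePow_succ, sub_add_cancel]
  -- The difference `n - n'` is `σ * (t - s) / 2`, which is `0` for `s = t` and `±1` otherwise.
  rcases Int.units_eq_one_or s with rfl | rfl <;> rcases Int.units_eq_one_or t with rfl | rfl <;>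
    rcases Int.units_eq_one_or σ with rfl | rfl <;>
    simp only [Units.val_one, Units.val_neg] at key
  · obtain rfl : n = n' := by omega
    simp
  · obtain rfl : n = n' := by omega
    simp
  · obtain rfl : n = n' - 1 := by omega
    simp [hone]
  · obtain rfl : n = n' + 1 := by omega
    simp [Int.negOnePow_succ]
  · obtain rfl : n = n' + 1 := by omega
    simp [Int.negOnePow_succ]
  · obtain rfl : n = n' - 1 := by omega
    simp [hone]
  · obtain rfl : n = n' := by omega
    simp
  · obtain rfl : n = n' := by omega
    simp

end IsCornerRegion

end Branches

/-! ### Corners and the entries of the matrix. -/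

namespace Branches

variable {y : E}

lemma corner_inj (B : D.Branches y) {s t s' t' : ℤˣ} :
    B.corner s t = B.corner s' t' ↔ s = s' ∧ t = t' := by
  refine ⟨fun h => ?_, by rintro ⟨rfl, rfl⟩; rfl⟩
  have h1 := LinearIndependent.pair_iff.1 B.indep (((s : ℤ) : ℝ) - ((s' : ℤ) : ℝ))
    (((t : ℤ) : ℝ) - ((t' : ℤ) : ℝ)) (by
      rw [corner, corner] at h
      rw [sub_smul, sub_smul]
      rw [← sub_eq_zero] at h
      rw [← h]
      abel)
  have h2 := sub_eq_zero.1 h1.1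
  have h3 := sub_eq_zero.1 h1.2
  exact ⟨Units.ext (by exact_mod_cast h2), Units.ext (by exact_mod_cast h3)⟩

lemma exists_of_mem_halfTangents (B : D.Branches y) {h : E} (hh : h ∈ D.halfTangents y) :
    ∃ s : ℤˣ, h = ((s : ℤ) : ℝ) • deriv (D.curve B.i₁) B.t₁ ∨
      h = ((s : ℤ) : ℝ) • deriv (D.curve B.i₂) B.t₂ := by
  obtain ⟨i, t, hit, hd⟩ := hh
  obtain ⟨s, hs⟩ : ∃ s : ℤˣ, h = ((s : ℤ) : ℝ) • deriv (D.curve i) t := by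
    rcases hd with rfl | rfl
    exacts [⟨1, by simp⟩, ⟨-1, by simp⟩]
  refine ⟨s, ?_⟩
  obtain ⟨m, ⟨rfl, rfl⟩ | ⟨rfl, rfl⟩⟩ := B.all i t hit
  · left; rw [hs, D.deriv_curve_add_int]
  · right; rw [hs, D.deriv_curve_add_int]

lemma smul_mem_halfTangents {i : Fin D.l} {t : ℝ} (h : D.curve i t = y) (s : ℤˣ) :
    ((s : ℤ) : ℝ) • deriv (D.curve i) t ∈ D.halfTangents y := by
  refine ⟨i, t, h, ?_⟩
  rcases Int.units_eq_one_or s with rfl | rfl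
  · left; simp
  · right; simp

lemma not_linearIndependent_smul (a b : ℝ) (v : E) (hb : b ≠ 0) :
    ¬ LinearIndependent ℝ ![a • v, b • v] := fun h => by
  have := LinearIndependent.pair_iff.1 h b (-a) (by rw [smul_smul, smul_smul]; module)
  exact hb this.1

/-- Half-tangents of the same branch are parallel, so an independent pair takes one from each
branch. -/
lemma mem_corners_iff {y : D.Crossing} (B : D.Branches y.1) {w : E} :
    w ∈ D.corners y ↔ ∃ s t, w = B.corner s t := by
  constructor
  · rintro ⟨h, hh, k, hk, hind, rfl⟩
    obtain ⟨s, rfl | rfl⟩ := B.exists_of_mem_halfTangents hh <;>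
      obtain ⟨t, rfl | rfl⟩ := B.exists_of_mem_halfTangents hk
    · exact absurd hind (not_linearIndependent_smul _ _ _ (cast_unit_ne_zero t))
    · exact ⟨s, t, rfl⟩
    · exact ⟨t, s, add_comm _ _⟩
    · exact absurd hind (not_linearIndependent_smul _ _ _ (cast_unit_ne_zero t))
  · rintro ⟨s, t, rfl⟩
    refine ⟨_, smul_mem_halfTangents B.hit₁ s, _, smul_mem_halfTangents B.hit₂ t, ?_, rfl⟩
    refine LinearIndependent.pair_iff.2 fun a b hab => ?_
    rw [smul_smul, smul_smul] at hab
    have := LinearIndependent.pair_iff.1 B.indep _ _ hab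
    exact ⟨(mul_eq_zero.1 this.1).resolve_right (cast_unit_ne_zero s),
      (mul_eq_zero.1 this.2).resolve_right (cast_unit_ne_zero t)⟩

namespace IsCornerRegion

variable {P : D.PlanarChart} {R : ℤˣ → ℤˣ → D.Region}

lemma fderiv_φ_corner (B : D.Branches y) (P : D.PlanarChart) (s t : ℤˣ) :
    fderiv ℝ P.φ y (B.corner s t) = B.dir P s t := by
  have hφ : HasFDerivAt P.φ (fderiv ℝ P.φ y) y :=
    ((P.contDiffOn_φ.contDiffAt (P.isOpen_U.mem_nhds
      (P.image_subset B.mem_image))).differentiableAt one_ne_zero).hasFDerivAt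
  have hψ : HasFDerivAt P.ψ (fderiv ℝ P.ψ (P.φ y)) (P.φ y) :=
    (P.contDiff_ψ.differentiable one_ne_zero _).hasFDerivAt
  have hcomp : HasFDerivAt (P.φ ∘ P.ψ) ((fderiv ℝ P.φ y).comp (fderiv ℝ P.ψ (P.φ y))) (P.φ y) :=
    HasFDerivAt.comp _ (by rwa [B.ψ_φ P]) hψ
  have hid : P.φ ∘ P.ψ = id := funext P.φ_ψ
  rw [hid] at hcomp
  have := hcomp.unique (hasFDerivAt_id _)
  rw [← B.fderiv_dir P]
  exact congrArg (fun L : ℂ →L[ℝ] ℂ => L (B.dir P s t)) this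

lemma hasDerivWithinAt_φ_comp (B : D.Branches y) (P : D.PlanarChart) {c : ℝ → E} {s t : ℤˣ}
    (h0 : c 0 = y) (hc : HasDerivWithinAt c (B.corner s t) (Ioi 0) 0) :
    HasDerivWithinAt (P.φ ∘ c) (B.dir P s t) (Ioi 0) 0 := by
  have hφ : HasFDerivAt P.φ (fderiv ℝ P.φ y) (c 0) := by
    rw [h0]
    exact ((P.contDiffOn_φ.contDiffAt (P.isOpen_U.mem_nhds
      (P.image_subset B.mem_image))).differentiableAt one_ne_zero).hasFDerivAt
  rw [← fderiv_φ_corner]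
  exact hφ.comp_hasDerivWithinAt 0 hc

/-- Every curve leaving in a corner direction eventually runs in the region of that corner, so the
region does not depend on the curve; conversely, a straight ray in the chart serves as a witness. -/
lemma touchesAt_iff {y : D.Crossing} {B : D.Branches y.1} (h : B.IsCornerRegion P R)
    {R' : D.Region} {w : E} :
    D.TouchesAt R' y w ↔ ∃ s t, w = B.corner s t ∧ R' = R s t := by
  constructor
  · rintro ⟨hw, c, h0, hc, hev⟩
    obtain ⟨s, t, rfl⟩ := B.mem_corners_iff.1 hw
    refine ⟨s, t, rfl, ?_⟩
    have h1 := h.eventually_mem s t (P.φ ∘ c) (by rw [Function.comp_apply, h0])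
      (hasDerivWithinAt_φ_comp B P h0 hc)
    have hct : Tendsto c (𝓝[>] 0) (𝓝 y.1) := by
      rw [← h0]; exact hc.continuousWithinAt
    have h2 := hct.eventually_mem (P.isOpen_U.mem_nhds (P.image_subset B.mem_image))
    obtain ⟨r, hr1, hr2, hr3⟩ := (h1.and (hev.and h2)).exists
    rw [Function.comp_apply, P.ψ_φ _ ⟨(R'.subset hr2).1, hr3⟩] at hr1
    exact Region.eq_of_mem hr2 hr1
  · rintro ⟨s, t, rfl, rfl⟩
    refine ⟨B.mem_corners_iff.2 ⟨s, t, rfl⟩, fun r => P.ψ (P.φ y.1 + r * B.dir P s t), ?_, ?_,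
      h.eventually_ray s t⟩
    · simp [B.ψ_φ P]
    · rw [← B.fderiv_dir P]
      have hψ : HasFDerivAt P.ψ (fderiv ℝ P.ψ (P.φ y.1)) (P.φ y.1 + (0 : ℝ) * B.dir P s t) := by
        rw [Complex.ofReal_zero, zero_mul, add_zero]
        exact (P.contDiff_ψ.differentiable one_ne_zero _).hasFDerivAt
      exact (hψ.comp_hasDerivAt (0 : ℝ) (hasDerivAt_ray _ _)).hasDerivWithinAt

lemma mem_boundary_iff {B : D.Branches y} (h : B.IsCornerRegion P R) {R' : D.Region} :
    y ∈ D.boundary R' ↔ ∃ s t, R' = R s t := by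
  refine ⟨fun hy => h.eq_of_mem_closure R' hy.1, ?_⟩
  rintro ⟨s, t, rfl⟩
  refine ⟨?_, fun hy => ((R s t).subset hy).2 B.mem_image⟩
  refine mem_closure_of_tendsto (f := fun r : ℝ => P.ψ (P.φ y + r * B.dir P s t))
    (b := 𝓝[>] 0) ?_ (h.eventually_ray s t)
  have := (P.contDiff_ψ.continuous.tendsto (P.φ y)).comp (tendsto_ray (P.φ y) (B.dir P s t))
  rwa [B.ψ_φ P] at this

lemma touchesTwice_iff {y : D.Crossing} {B : D.Branches y.1} (h : B.IsCornerRegion P R)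
    {R' : D.Region} :
    D.TouchesTwice R' y ↔ ∃ s t s' t', ¬(s = s' ∧ t = t') ∧ R' = R s t ∧ R' = R s' t' := by
  constructor
  · rintro ⟨w, w', hne, hw, hw'⟩
    obtain ⟨s, t, rfl, h1⟩ := h.touchesAt_iff.1 hw
    obtain ⟨s', t', rfl, h2⟩ := h.touchesAt_iff.1 hw'
    exact ⟨s, t, s', t', fun e => hne (B.corner_inj.2 e), h1, h2⟩
  · rintro ⟨s, t, s', t', hne, h1, h2⟩
    exact ⟨_, _, fun e => hne (B.corner_inj.1 e), h.touchesAt_iff.2 ⟨s, t, rfl, h1⟩,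
      h.touchesAt_iff.2 ⟨s', t', rfl, h2⟩⟩

open Classical in
/-- The entries of the matrix of the double counting rule count corners. -/
lemma matrixD2_eq {y : D.Crossing} {B : D.Branches y.1} (h : B.IsCornerRegion P R)
    {ε : D.Region → ℤˣ} (hε : ∀ s t, ε (R s t) = ε (R 1 1) * (s * t)) (R' : D.Region) :
    D.matrixD2 y R' = ∑ s, ∑ t, if R' = R s t then 1 else 0 := by
  -- Adjacent corners have different colors, hence different regions. A region therefore has at most
  -- two corners at `y`, so the entries `0`, `1`, `2` count them.
  have hadj : ∀ s t s' t', s * t ≠ s' * t' → ¬(R' = R s t ∧ R' = R s' t') := by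
    rintro s t s' t' hne ⟨h1, h2⟩
    have := congrArg ε (h1.symm.trans h2)
    rw [hε s t, hε s' t'] at this
    exact hne (mul_left_cancel this)
  have a1 := hadj 1 1 1 (-1) (by decide)
  have a2 := hadj 1 1 (-1) 1 (by decide)
  have a3 := hadj (-1) (-1) 1 (-1) (by decide)
  have a4 := hadj (-1) (-1) (-1) 1 (by decide)
  have h1 : (1 : ℤˣ) ≠ -1 := by decide
  have h2 : (-1 : ℤˣ) ≠ 1 := by decide
  rw [sum_units, matrixD2, matrixD1]
  simp only [Matrix.of_apply, h.touchesTwice_iff, h.mem_boundary_iff, exists_units]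
  generalize (R' = R 1 1) = q₁ at a1 a2 a3 a4 ⊢
  generalize (R' = R 1 (-1)) = q₂ at a1 a2 a3 a4 ⊢
  generalize (R' = R (-1) 1) = q₃ at a1 a2 a3 a4 ⊢
  generalize (R' = R (-1) (-1)) = q₄ at a1 a2 a3 a4 ⊢
  by_cases p₁ : q₁ <;> by_cases p₂ : q₂ <;> by_cases p₃ : q₃ <;> by_cases p₄ : q₄ <;>
    simp_all

end IsCornerRegion

end Branches

/-! ### Construction of the vector. -/

lemma Crossing.nonempty_branches (y : D.Crossing) : Nonempty (D.Branches y.1) := by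
  obtain ⟨y, i, j, s, t, hs, ht, hne, h1, h2⟩ := y
  exact ⟨branchesOf hs ht hne h1 h2⟩

lemma IsSelfCrossing.exists_lt {x : D.Crossing} (hx : D.IsSelfCrossing x) :
    ∃ i s t, s ∈ Ico (0 : ℝ) 1 ∧ t ∈ Ico (0 : ℝ) 1 ∧ s < t ∧
      D.curve i s = x.1 ∧ D.curve i t = x.1 := by
  obtain ⟨i, s, t, hs, ht, hne, h1, h2⟩ := hx
  rcases lt_or_gt_of_ne hne with h | h
  exacts [⟨i, s, t, hs, ht, h, h1, h2⟩, ⟨i, t, s, ht, hs, h, h2, h1⟩]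

open Classical in
/-- The product of the matrix with a vector is a sum over the corners. -/
lemma applyD2_onFinset (T : Finset D.Region) (f : D.Region → ℤ) (hf : ∀ R, f R ≠ 0 → R ∈ T)
    (y : D.Crossing) {C : ℤˣ → ℤˣ → D.Region} (hC : ∀ s t, C s t ∈ T)
    (hA : ∀ R, D.matrixD2 y R = ∑ s, ∑ t, if R = C s t then 1 else 0) :
    D.applyD2 (Finsupp.onFinset T f hf) y = ∑ s, ∑ t, f (C s t) := by
  rw [applyD2, Finsupp.onFinset_sum hf fun _ => mul_zero _]
  simp only [hA, Finset.sum_mul, ite_mul, one_mul, zero_mul]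
  rw [Finset.sum_comm]
  refine Finset.sum_congr rfl fun s _ => ?_
  rw [Finset.sum_comm]
  refine Finset.sum_congr rfl fun t _ => ?_
  rw [Finset.sum_ite_eq', if_pos (hC s t)]

open Classical in
-- The coloring `ε` turns plain sums over corners into alternating sums of the winding number `F` of
-- the loop, which detect only its base point.
theorem PlanarChart.exists_region_vector (P : D.PlanarChart) {x : D.Crossing}
    (hx : D.IsSelfCrossing x) :
    ∃ v : D.Region →₀ ℤ, D.applyD2 v x = 1 ∧ ∀ y : D.Crossing, y ≠ x → D.applyD2 v y = 0 := by
  obtain ⟨i, s₀, t₀, hs, ht, hlt, h1, h2⟩ := hx.exists_lt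
  have hne : (i, s₀) ≠ (i, t₀) := fun e => hlt.ne (congrArg Prod.snd e)
  have B' : ∀ y : D.Crossing, D.Branches y.1 := fun y => y.nonempty_branches.some
  -- At `x` the branches are ordered so that the loop leaves along the first and returns along the
  -- second; elsewhere any choice will do.
  set B₀ : D.Branches x.1 := branchesOf hs ht hne h1 h2 with hB₀
  obtain ⟨R₀, hR₀m, hR₀c⟩ := B₀.exists_cornerRegion P
  have hR₀ : B₀.IsCornerRegion P R₀ := ⟨hR₀m, hR₀c⟩
  choose C hCm hCc using fun y : D.Crossing => (B' y).exists_cornerRegion P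
  have hC : ∀ y, (B' y).IsCornerRegion P (C y) := fun y => ⟨hCm y, hCc y⟩
  obtain ⟨F, hF⟩ := P.exists_winding i hlt.le (h1.trans h2.symm)
  choose N hN using fun j : Fin D.l => P.exists_winding j (s := 0) (t := 1) zero_le_one
    (by simpa using (D.curve_add_int j 0 1).symm)
  set ε : D.Region → ℤˣ := fun R => (∑ j, N j R).negOnePow with hε
  have hε₀ : ∀ s t, ε (R₀ s t) = ε (R₀ 1 1) * (s * t) := hR₀.negOnePow_total_winding hN
  have hεC : ∀ y s t, ε (C y s t) = ε (C y 1 1) * (s * t) := fun y =>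
    (hC y).negOnePow_total_winding hN
  obtain ⟨σ, hσ⟩ := hR₀.alternating_sum_base rfl hlt (fun τ hτ e => by
    have hτ' : τ ∈ Ico (0 : ℝ) 1 := ⟨hs.1.trans hτ.1.le, hτ.2.trans ht.2⟩
    rcases eq_or_eq_of_hits hne ⟨hs, h1⟩ ⟨ht, h2⟩ (q := (i, τ)) ⟨hτ', e⟩ with h | h
    · exact hτ.1.ne' (congrArg Prod.snd h)
    · exact hτ.2.ne (congrArg Prod.snd h)) hF
  have hfin := D.finite_crossing
  have hTfin : (range (fun q : ℤˣ × ℤˣ => R₀ q.1 q.2) ∪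
      range fun q : D.Crossing × ℤˣ × ℤˣ => C q.1 q.2.1 q.2.2).Finite :=
    (finite_range _).union (finite_range _)
  -- Finite support costs nothing: every region at a corner of a crossing belongs to `T`.
  set T := hTfin.toFinset with hT
  have hT₀ : ∀ s t, R₀ s t ∈ T := fun s t => hTfin.mem_toFinset.2 (Or.inl ⟨(s, t), rfl⟩)
  have hTC : ∀ y s t, C y s t ∈ T := fun y s t =>
    hTfin.mem_toFinset.2 (Or.inr ⟨(y, s, t), rfl⟩)
  -- This global sign normalizes the component at `x` from `±1` to `1`.
  set κ : ℤˣ := σ * ε (R₀ 1 1) with hκ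
  set f : D.Region → ℤ := fun R => if R ∈ T then ((κ * ε R : ℤˣ) : ℤ) * F R else 0 with hf
  have hfT : ∀ R ∈ T, f R = ((κ * ε R : ℤˣ) : ℤ) * F R := fun R h => if_pos h
  have hsum : ∀ Q : ℤˣ → ℤˣ → D.Region, (∀ s t, Q s t ∈ T) →
      (∀ s t, ε (Q s t) = ε (Q 1 1) * (s * t)) → ∑ s, ∑ t, f (Q s t)
        = ((κ * ε (Q 1 1) : ℤˣ) : ℤ) * ∑ s, ∑ t, ((s * t : ℤˣ) : ℤ) * F (Q s t) := by
    intro Q hQ hQε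
    simp only [Finset.mul_sum]
    refine Finset.sum_congr rfl fun s _ => Finset.sum_congr rfl fun t _ => ?_
    rw [hfT _ (hQ s t), hQε s t]
    push_cast
    ring
  refine ⟨Finsupp.onFinset T f fun R h => by_contra fun hn => h (if_neg hn), ?_, fun y hy => ?_⟩
  · rw [applyD2_onFinset T f _ x hT₀ (hR₀.matrixD2_eq hε₀), hsum _ hT₀ hε₀, hσ, ← Units.val_mul, hκ]
    have : σ * ε (R₀ 1 1) * ε (R₀ 1 1) * σ = 1 := by
      rw [mul_assoc σ, Int.units_mul_self, mul_one, Int.units_mul_self]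
    rw [this, Units.val_one]
  · have hxy : x.1 ≠ y.1 := fun e => hy (Subtype.ext e.symm)
    rw [applyD2_onFinset T f _ y (hTC y) ((hC y).matrixD2_eq (hεC y)), hsum _ (hTC y) (hεC y),
      (hC y).alternating_sum_eq_zero hlt.le (by rwa [h1]) (by rwa [h2])
        (D.finite_hits y.1 i fun τ hτ => ⟨hs.1.trans hτ.1, hτ.2.trans_lt ht.2⟩) hF, mul_zero]

/-! ### Charts of the plane and the sphere. -/

/-- Otherwise the cones over the curves would cover all nonzero vectors, a set of Hausdorff
dimension three, although each cone is a `C¹` image of a plane. -/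
lemma exists_sphere_point_notMem_image
    (D : LinkProjection (Metric.sphere (0 : EuclideanSpace ℝ (Fin 3)) 1)) :
    ∃ p ∈ Metric.sphere (0 : EuclideanSpace ℝ (Fin 3)) 1, p ∉ D.image := by
  by_contra! hcon
  set f : Fin D.l → ℝ × ℝ → EuclideanSpace ℝ (Fin 3) := fun i q => q.1 • D.curve i q.2 with hf
  have hfc : ∀ i, ContDiff ℝ 1 (f i) := fun i =>
    contDiff_fst.smul ((D.contDiff_curve i).comp contDiff_snd)
  have hcov : ({0}ᶜ : Set (EuclideanSpace ℝ (Fin 3))) ⊆ ⋃ i, range (f i) := by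
    intro v hv
    have hv0 : ‖v‖ ≠ 0 := norm_ne_zero_iff.2 hv
    obtain ⟨i, t, hit⟩ := hcon (‖v‖⁻¹ • v) (by
      rw [mem_sphere_zero_iff_norm, norm_smul, norm_inv, norm_norm, inv_mul_cancel₀ hv0])
    refine mem_iUnion.2 ⟨i, (‖v‖, t), ?_⟩
    simp only [hf, hit]
    rw [smul_smul, mul_inv_cancel₀ hv0, one_smul]
  have h1 : dimH (⋃ i, range (f i)) ≤ 2 := by
    rw [dimH_iUnion]
    refine iSup_le fun i => (hfc i).dimH_range_le.trans ?_
    simp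
  have h2 : dimH ({0}ᶜ : Set (EuclideanSpace ℝ (Fin 3))) = 3 := by
    obtain ⟨v, hv⟩ := exists_ne (0 : EuclideanSpace ℝ (Fin 3))
    rw [Real.dimH_of_mem_nhds (isOpen_compl_singleton.mem_nhds hv)]
    simp
  have h3 := (dimH_mono hcov).trans h1
  rw [h2] at h3
  exact absurd h3 (by norm_num)

/-- The plane as a chart. -/
noncomputable def planeChart
    (D : LinkProjection (Set.univ : Set (EuclideanSpace ℝ (Fin 2)))) : D.PlanarChart :=
  let e : EuclideanSpace ℝ (Fin 2) ≃L[ℝ] ℂ := ContinuousLinearEquiv.ofFinrankEq (by simp)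
  { U := univ
    φ := e
    ψ := e.symm
    isOpen_U := isOpen_univ
    contDiffOn_φ := e.contDiff.contDiffOn
    contDiff_ψ := e.symm.contDiff
    ψ_mem := fun _ => ⟨mem_univ _, mem_univ _⟩
    φ_ψ := e.apply_symm_apply
    ψ_φ := fun p _ => e.symm_apply_apply p
    image_subset := subset_univ _ }

/-- The stereographic chart of the sphere. -/
noncomputable def sphereChart
    (D : LinkProjection (Metric.sphere (0 : EuclideanSpace ℝ (Fin 3)) 1))
    {p : EuclideanSpace ℝ (Fin 3)} (hp : ‖p‖ = 1) (hpD : p ∉ D.image) : D.PlanarChart :=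
  have hrank : Module.finrank ℝ (ℝ ∙ p)ᗮ = Module.finrank ℝ ℂ := by
    have h3 : Fact (Module.finrank ℝ (EuclideanSpace ℝ (Fin 3)) = 2 + 1) := ⟨by simp⟩
    rw [Submodule.finrank_orthogonal_span_singleton (n := 2) (by
      intro e; simp [e] at hp), Complex.finrank_real_complex]
  let e : (ℝ ∙ p)ᗮ ≃L[ℝ] ℂ := ContinuousLinearEquiv.ofFinrankEq hrank
  -- By the equality case of Cauchy–Schwarz, the chart domain meets the sphere in the complement of
  -- the pole `p`.
  have hU : ∀ q ∈ Metric.sphere (0 : EuclideanSpace ℝ (Fin 3)) 1, q ≠ p → inner ℝ p q ≠ (1 : ℝ) := by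
    intro q hq hne h
    exact hne ((inner_eq_one_iff_of_norm_eq_one hp (mem_sphere_zero_iff_norm.1 hq)).1 h).symm
  have hU' : ∀ q, inner ℝ p q ≠ (1 : ℝ) → q ≠ p := by
    rintro q h rfl
    exact h (by rw [real_inner_self_eq_norm_sq, hp, one_pow])
  { U := {q | innerSL ℝ p q ≠ (1 : ℝ)}
    φ := fun q => e (stereoToFun p q)
    ψ := fun z => stereoInvFunAux p (e.symm z)
    isOpen_U := isOpen_ne_fun (innerSL ℝ p).continuous continuous_const
    contDiffOn_φ := e.contDiff.comp_contDiffOn contDiffOn_stereoToFun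
    contDiff_ψ := contDiff_stereoInvFunAux.comp
      ((ℝ ∙ p)ᗮ.subtypeL.contDiff.comp e.symm.contDiff)
    ψ_mem := fun z => by
      have h1 := (stereoInvFun hp (e.symm z)).2
      refine ⟨h1, hU _ h1 fun h => stereoInvFun_ne_north_pole hp (e.symm z) (Subtype.ext h)⟩
    φ_ψ := fun z => (congrArg e (stereo_right_inv hp (e.symm z))).trans (e.apply_symm_apply z)
    ψ_φ := fun q hq => by
      have := stereo_left_inv hp (x := ⟨q, hq.1⟩) (hU' q hq.2)
      have h2 := congrArg Subtype.val this
      simp only [e.symm_apply_apply]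
      exact h2
    image_subset := by
      rintro _ ⟨i, t, rfl⟩
      exact hU _ (D.mem_surface i t) fun h => hpD ⟨i, t, h⟩ }

end LinkProjection

theorem mainTheorem9 :
    (∀ (D : LinkProjection (Set.univ : Set (EuclideanSpace ℝ (Fin 2)))) (x : D.Crossing),
      D.IsSelfCrossing x →
        ∃ v : D.Region →₀ ℤ, D.applyD2 v x = 1 ∧ ∀ y : D.Crossing, y ≠ x → D.applyD2 v y = 0) ∧
    (∀ (D : LinkProjection (Metric.sphere (0 : EuclideanSpace ℝ (Fin 3)) 1)) (x : D.Crossing),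
      D.IsSelfCrossing x →
        ∃ v : D.Region →₀ ℤ, D.applyD2 v x = 1 ∧ ∀ y : D.Crossing, y ≠ x → D.applyD2 v y = 0) := by
  refine ⟨fun D x hx => D.planeChart.exists_region_vector hx, fun D x hx => ?_⟩
  obtain ⟨p, hp, hpD⟩ := D.exists_sphere_point_notMem_image
  exact (D.sphereChart (mem_sphere_zero_iff_norm.1 hp) hpD).exists_region_vector hx
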